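/- Let $\Omega\subset\mathbb R^d$ be a bounded connected open set with $0\in\Omega$, let $1<p\le d$, let $\varepsilon_k>0$ with $\varepsilon_k\to0$, and let $B_r$ denote the open ball of centre $0$ and radius $r$. For $u\in W^{1,p}_0(\Omega)$ (the closure of $C^\infty_c(\Omega)$ in the Sobolev norm) put $$F_k(u)=\frac1{|B_{\varepsilon_k}|}\int_\Omega\int_{B_{\varepsilon_k}\cap\Omega}|u(x)-u(y)|^p\,dy\,dx+\int_\Omega|\nabla u(x)|^p\,dx ,$$ and let $F\colon W^{1,p}_0(\Omega)\to[-\infty,+\infty]$ be the sequential $\Gamma$-limit of $(F_k)$ with respect to weak convergence in $W^{1,p}_0(\Omega)$; that is, $F(u)\le\liminf_kF_k(u_k)$ whenever $u_k\rightharpoonup u$, and for every $u$ there are $u_k\rightharpoonup u$ with $\limsup_kF_k(u_k)\le F(u)$. Write $\Delta=\{(x,x):x\in\Omega\}$, $\sigma(x,y)=(y,x)$, and $\mathcal L^{2d}$ for Lebesgue measure on $\Omega\times\Omega$. (1) Suppose that there are continuous functions $f\colon\mathbb R^2\to\mathbb R$, $g\colon\mathbb R\to\mathbb R$ and positive bounded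 Radon measures $\mu$ on $\Omega\times\Omega$ and $\nu$ on $\Omega$ such that $$F(u)=\int_{\Omega\times\Omega}f(u(x),u(y))\,d\mu(x,y)+\int_\Omega g(u(x))\,d\nu(x)+\int_\Omega|\nabla u(x)|^p\,dx\qquad\text{for all }u\in C^\infty_c(\Omega).\tag{R}$$ Then $p=2$, and the representation is determined up to normalization in the following sense. (a) There is a constant $c>0$ such that $f(s,t)+f(t,s)-f(s,s)-f(t,t)=2c\,|s-t|^2$ for all $s,t\in\mathbb R$, and $\mu(E)+\mu(\sigma^{-1}(E))=\frac1{c|\Omega|}\mathcal L^{2d}(E)$ for every Borel set $E\subset\Omega\times\Omega$ with $E\cap\Delta=\emptyset$. (b) If $f$ is symmetric and vanishes on the diagonal ($f(s,t)=f(t,s)$ and $f(s,s)=0$ for all $s,t$), then $\nu=0$ or $g\equiv0$. (c) If $f$ is symmetric, vanishes on the diagonal and satisfies $f(1,0)=1$, if $\mu$ is symmetric ($\sigma_\#\mu=\mu$) with $\mu(\Delta)=0$, and if $g\not\equiv0$, then $\mu=\frac1{2|\Omega|}\mathcal L^{2d}$, $\nu=0$, and $f(s,t)=|s-t|^2$ for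 all $s,t\in\mathbb R$. (2) Conversely, if $p=2$ (and hence $d\ge2$), then (R) holds with $f(s,t)=|s-t|^2$, $\mu=\frac1{2|\Omega|}\mathcal L^{2d}$, $\nu=0$ and any $g$. -/

import Mathlib

open MeasureTheory Filter Topology TopologicalSpace
open scoped ENNReal ContDiff Distributions Gradient

noncomputable section

instance factOneLeOfReal (p : ℝ) [hp : Fact (1 < p)] : Fact (1 ≤ ENNReal.ofReal p) :=
  ⟨by simpa using ENNReal.ofReal_le_ofReal hp.out.le⟩

section Sobolev

variable {d : ℕ} (Ω : Opens (EuclideanSpace ℝ (Fin d)))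

/-- The space `L^p(Ω) × L^p(Ω; ℝ^d)` of pairs `(u, ∇u)`. -/
abbrev LpPair (p : ℝ) : Type :=
  Lp ℝ (ENNReal.ofReal p) (volume.restrict (Ω : Set (EuclideanSpace ℝ (Fin d)))) ×
    Lp (EuclideanSpace ℝ (Fin d)) (ENNReal.ofReal p)
      (volume.restrict (Ω : Set (EuclideanSpace ℝ (Fin d))))

variable {Ω}

theorem TestFunction.memLp_self (p : ℝ) (φ : 𝓓(Ω, ℝ)) :
    MemLp (fun x => φ x) (ENNReal.ofReal p)
      (volume.restrict (Ω : Set (EuclideanSpace ℝ (Fin d)))) :=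
  φ.continuous.memLp_of_hasCompactSupport φ.hasCompactSupport

theorem TestFunction.continuous_gradient (φ : 𝓓(Ω, ℝ)) : Continuous (fun x => ∇ φ x) :=
  (InnerProductSpace.toDual ℝ (EuclideanSpace ℝ (Fin d))).symm.continuous.comp
    (φ.contDiff.continuous_fderiv (by simp))

theorem TestFunction.hasCompactSupport_gradient (φ : 𝓓(Ω, ℝ)) :
    HasCompactSupport (fun x => ∇ φ x) :=
  (φ.hasCompactSupport.fderiv ℝ).comp_left
    (g := (InnerProductSpace.toDual ℝ (EuclideanSpace ℝ (Fin d))).symm) (map_zero _)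

theorem TestFunction.memLp_gradient (p : ℝ) (φ : 𝓓(Ω, ℝ)) :
    MemLp (fun x => ∇ φ x) (ENNReal.ofReal p)
      (volume.restrict (Ω : Set (EuclideanSpace ℝ (Fin d)))) :=
  φ.continuous_gradient.memLp_of_hasCompactSupport φ.hasCompactSupport_gradient

theorem TestFunction.differentiable' (φ : 𝓓(Ω, ℝ)) : Differentiable ℝ φ :=
  φ.contDiff.differentiable (by simp)

variable (Ω)

/-- The linear map `φ ↦ (φ, ∇φ)` from `C_c^∞(Ω)` to `L^p(Ω) × L^p(Ω; ℝ^d)`. -/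
def testToPair (p : ℝ) : 𝓓(Ω, ℝ) →ₗ[ℝ] LpPair Ω p where
  toFun φ := ((φ.memLp_self p).toLp _, (φ.memLp_gradient p).toLp _)
  map_add' φ ψ := by
    refine Prod.ext ?_ ?_
    · exact MemLp.toLp_add (φ.memLp_self p) (ψ.memLp_self p)
    · refine Eq.trans (MemLp.toLp_congr ((φ + ψ).memLp_gradient p) ((φ.memLp_gradient p).add (ψ.memLp_gradient p))
        (Eventually.of_forall fun x => ?_))
        (MemLp.toLp_add (φ.memLp_gradient p) (ψ.memLp_gradient p))
      have h : fderiv ℝ (⇑(φ + ψ)) x = fderiv ℝ φ x + fderiv ℝ ψ x :=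
        fderiv_add (φ.differentiable' x) (ψ.differentiable' x)
      exact (congrArg _ h).trans (map_add _ _ _)
  map_smul' c φ := by
    refine Prod.ext ?_ ?_
    · exact MemLp.toLp_const_smul c (φ.memLp_self p)
    · refine Eq.trans (MemLp.toLp_congr ((c • φ).memLp_gradient p) ((φ.memLp_gradient p).const_smul c)
        (Eventually.of_forall fun x => ?_))
        (MemLp.toLp_const_smul c (φ.memLp_gradient p))
      have h : fderiv ℝ (⇑(c • φ)) x = c • fderiv ℝ φ x :=
        fderiv_const_smul (φ.differentiable' x) c
      exact (congrArg _ h).trans (by simp [gradient])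

/-- `W₀^{1,p}(Ω)`: the closure of `C_c^∞(Ω)` in the Sobolev norm. An element is the pair
`(u, ∇u)` of a function and its weak gradient, with the norm `max(‖u‖_p, ‖∇u‖_p)`, which is
equivalent to the usual one. -/
def W0 (p : ℝ) [Fact (1 < p)] : Submodule ℝ (LpPair Ω p) :=
  (LinearMap.range (testToPair Ω p)).topologicalClosure

/-- The inclusion `C_c^∞(Ω) ⊆ W₀^{1,p}(Ω)`. -/
def testToW0 (p : ℝ) [Fact (1 < p)] (φ : 𝓓(Ω, ℝ)) : W0 Ω p :=
  ⟨testToPair Ω p φ, Submodule.le_topologicalClosure _ ⟨φ, rfl⟩⟩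

variable {Ω}

/-- The function `u ∈ L^p(Ω)` underlying an element of `W₀^{1,p}(Ω)`. -/
def w0Val {p : ℝ} [Fact (1 < p)] (u : W0 Ω p) :
    Lp ℝ (ENNReal.ofReal p) (volume.restrict (Ω : Set (EuclideanSpace ℝ (Fin d)))) :=
  (u : LpPair Ω p).1

/-- The weak gradient of an element of `W₀^{1,p}(Ω)`. -/
def w0Grad {p : ℝ} [Fact (1 < p)] (u : W0 Ω p) :
    Lp (EuclideanSpace ℝ (Fin d)) (ENNReal.ofReal p)
      (volume.restrict (Ω : Set (EuclideanSpace ℝ (Fin d)))) :=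
  (u : LpPair Ω p).2

/-- The functional
`u ↦ |B_r|⁻¹ ∫_Ω ∫_{B_r} |u(x) - u(y)|^p dy dx + ∫_Ω |∇u|^p dx`, where `B_r` is the ball with
centre `0` and radius `r`. The inner integral runs over `B_r ∩ Ω`, which is `B_r` as soon as
`r` is small. -/
def ballEnergy {p : ℝ} [Fact (1 < p)] (r : ℝ) (u : W0 Ω p) : ℝ :=
  (volume.real (Metric.ball (0 : EuclideanSpace ℝ (Fin d)) r))⁻¹ *
      (∫ x in (Ω : Set (EuclideanSpace ℝ (Fin d))),
        ∫ y in Metric.ball (0 : EuclideanSpace ℝ (Fin d)) r ∩ Ω, |w0Val u x - w0Val u y| ^ p) +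
    ∫ x in (Ω : Set (EuclideanSpace ℝ (Fin d))), ‖w0Grad u x‖ ^ p

variable (Ω) in
/-- Lebesgue measure on `Ω`. -/
def lebesgueOn : Measure Ω :=
  Measure.comap (Subtype.val : Ω → EuclideanSpace ℝ (Fin d)) volume

variable (Ω) in
/-- Lebesgue measure on `Ω × Ω`. -/
def lebesgueOnProd : Measure (Ω × Ω) := (lebesgueOn Ω).prod (lebesgueOn Ω)

/-- `F(u) = ∫_{Ω×Ω} f(u(x),u(y)) dμ + ∫_Ω g(u) dν + ∫_Ω |∇u|^p dx` for all `u ∈ C_c^∞(Ω)`. -/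
def IsRepresentedBy {p : ℝ} [Fact (1 < p)] (F : W0 Ω p → EReal) (f : ℝ × ℝ → ℝ) (g : ℝ → ℝ)
    (μ : Measure (Ω × Ω)) (ν : Measure Ω) : Prop :=
  ∀ φ : 𝓓(Ω, ℝ), F (testToW0 Ω p φ) =
    (((∫ z : Ω × Ω, f (φ z.1, φ z.2) ∂μ) + (∫ x : Ω, g (φ x) ∂ν) +
      ∫ x in (Ω : Set (EuclideanSpace ℝ (Fin d))), ‖∇ φ x‖ ^ p : ℝ) : EReal)

end Sobolev

section Gamma

variable {X : Type*} [NormedAddCommGroup X] [NormedSpace ℝ X]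

/-- Weak convergence of a sequence in a normed space. -/
def WeaklyTendsto (us : ℕ → X) (u : X) : Prop :=
  Tendsto (fun k => toWeakSpace ℝ X (us k)) atTop (𝓝 (toWeakSpace ℝ X u))

/-- `F` is the (sequential) `Γ`-limit of `Fk` with respect to weak convergence in `X`. -/
def IsWeakGammaLimit (Fk : ℕ → X → EReal) (F : X → EReal) : Prop :=
  (∀ (u : X) (us : ℕ → X), WeaklyTendsto us u →
      F u ≤ liminf (fun k => Fk k (us k)) atTop) ∧
    ∀ u : X, ∃ us : ℕ → X, WeaklyTendsto us u ∧
      limsup (fun k => Fk k (us k)) atTop ≤ F u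

end Gamma

end

/-!
Write `osc(u) = inf_c ∫_Ω |u - c|^p` (`lpOsc`), the `p`-th power of the `L^p`-distance from `u` to
the constants. The theorem rests on the formula `F(φ) = osc(φ) + ∫_Ω |∇φ|^p` for test functions
`φ` (`gammaLimit_testToW0_eq`).

For the lower bound (`lpOsc_add_le_of_isWeakGammaLimit`), the nonlocal term of `F_k(u)` is an average
over `y ∈ B_{ε_k}` of `∫ |u(x) - u(y)|^p dx ≥ osc(u)`, and both `osc` and the gradient term are powers
of norms of bounded linear images of `u`, hence weakly lower semicontinuous; no compact embedding is
needed. For the upper bound (`le_integral_add_of_isWeakGammaLimit`), points have zero `p`-capacity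
because `p ≤ d`, so that `φ` is a strong limit of test functions equal to a given constant `c` near
`0`; on such a function `F_k` is eventually `∫ |u - c|^p + ∫ |∇u|^p`. The cutoffs are averages of
`N` rescaled bumps with disjointly supported gradients (`multiscaleCutoff`).

A representation therefore says that `∫∫ f(φ(x), φ(y)) dμ + ∫ g(φ) dν = osc(φ)` for all test
functions, and by bounded approximation also for functions equal to `s` on a Borel set `A` and to `t`
off `A` (`integral_twoValued_eq_lpOsc`). Taking second differences in `A` removes the local term: for
disjoint `A` and `B` the second difference of `osc` is a multiple of `μ(A × B) + μ(B × A)`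
(`lpOsc_twoValued_union`), hence additive in `B`. Evaluating it on sets of volume `|Ω| / 4` gives
`((1 + T) / 2)^(p-1) = (1 + T^(p-1)) / 2` with `T^(p-1) = 3`, and strict convexity or concavity of
the power function leaves only `p = 2` (`exponent_eq_two`). For `p = 2` the second difference is
`-2 |s - t|² |A| |B| / |Ω|`, which determines the symmetrised kernel and the symmetrised measure on
products of disjoint sets, and these determine the measure off the diagonal
(`exists_kernel_and_measure`). Constant functions show that `g` or `ν` vanishes once `f` vanishes on
the diagonal. Conversely, for `p = 2`, `osc(u)` is `|Ω|` times the variance of `u` under normalised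
Lebesgue measure, which is the double integral of `|u(x) - u(y)|²` up to a factor
(`lpOsc_two_eq_integral_prod`).
-/

noncomputable section

/-! ### Distance to the constants in `L^p` -/

section Oscillation

variable {α : Type*} {m : MeasurableSpace α} (μ : Measure α)

/-- The `p`-th power of the `L^p(μ)`-distance from `u` to the constant functions. -/
def lpOsc (p : ℝ) (u : α → ℝ) : ℝ := ⨅ c : ℝ, ∫ x, |u x - c| ^ p ∂μ

variable {μ}

theorem bddBelow_integral_abs_sub_rpow (p : ℝ) (u : α → ℝ) :
    BddBelow (Set.range fun c : ℝ => ∫ x, |u x - c| ^ p ∂μ) :=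
  ⟨0, by rintro _ ⟨c, rfl⟩; exact integral_nonneg fun x => by positivity⟩

theorem lpOsc_le (p : ℝ) (u : α → ℝ) (c : ℝ) : lpOsc μ p u ≤ ∫ x, |u x - c| ^ p ∂μ :=
  ciInf_le (bddBelow_integral_abs_sub_rpow p u) c

theorem lpOsc_congr {p : ℝ} {u v : α → ℝ} (h : u =ᵐ[μ] v) : lpOsc μ p u = lpOsc μ p v := by
  unfold lpOsc
  congr 1
  funext c
  refine integral_congr_ae ?_
  filter_upwards [h] with x hx
  rw [hx]

theorem lpOsc_eq_of_forall_le {p : ℝ} {u : α → ℝ} {c₀ : ℝ}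
    (h : ∀ c : ℝ, ∫ x, |u x - c₀| ^ p ∂μ ≤ ∫ x, |u x - c| ^ p ∂μ) :
    lpOsc μ p u = ∫ x, |u x - c₀| ^ p ∂μ :=
  le_antisymm (lpOsc_le p u c₀) (le_ciInf h)

theorem norm_rpow_Lp_eq_integral {E : Type*} [NormedAddCommGroup E] {p : ℝ} (hp : 0 < p)
    (u : Lp E (ENNReal.ofReal p) μ) : ‖u‖ ^ p = ∫ x, ‖u x‖ ^ p ∂μ := by
  have h0 : ENNReal.ofReal p ≠ 0 := by simpa using hp
  rw [Lp.norm_def, (Lp.memLp u).eLpNorm_eq_integral_rpow_norm h0 ENNReal.ofReal_ne_top,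
    ENNReal.toReal_ofReal hp.le, ENNReal.toReal_ofReal (by positivity),
    ← Real.rpow_mul (integral_nonneg fun x => by positivity), inv_mul_cancel₀ hp.ne', Real.rpow_one]

variable [IsFiniteMeasure μ] {p : ℝ} [hp : Fact (1 < p)]

variable (μ p) in
/-- The constant functions in `L^p(μ)`. -/
def lpConstants : Submodule ℝ (Lp ℝ (ENNReal.ofReal p) μ) :=
  LinearMap.range (Lp.constₗ (E := ℝ) (ENNReal.ofReal p) μ ℝ)

instance : FiniteDimensional ℝ (lpConstants μ p) := by
  unfold lpConstants; infer_instance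

instance : IsClosed (lpConstants μ p : Set (Lp ℝ (ENNReal.ofReal p) μ)) :=
  Submodule.closed_of_finiteDimensional _

variable (μ p) in
/-- The projection of `L^p(μ)` onto its quotient by the constants. -/
def lpModConst : Lp ℝ (ENNReal.ofReal p) μ →L[ℝ] Lp ℝ (ENNReal.ofReal p) μ ⧸ lpConstants μ p :=
  (lpConstants μ p).mkQL

theorem norm_lpModConst_rpow_le (u : Lp ℝ (ENNReal.ofReal p) μ) (c : ℝ) :
    ‖lpModConst μ p u‖ ^ p ≤ ∫ x, |u x - c| ^ p ∂μ := by
  have hp0 : 0 < p := one_pos.trans hp.out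
  have h1 : lpModConst μ p u = lpModConst μ p (u - Lp.const (ENNReal.ofReal p) μ c) := by
    refine (Submodule.Quotient.eq _).2 ?_
    rw [sub_sub_cancel]
    exact ⟨c, rfl⟩
  have h2 : ‖lpModConst μ p u‖ ≤ ‖u - Lp.const (ENNReal.ofReal p) μ c‖ := by
    rw [h1]; exact Submodule.Quotient.norm_mk_le _ _
  calc _ ≤ ‖u - Lp.const (ENNReal.ofReal p) μ c‖ ^ p :=
        Real.rpow_le_rpow (norm_nonneg _) h2 hp0.le
    _ = _ := by
        rw [norm_rpow_Lp_eq_integral hp0]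
        refine integral_congr_ae ?_
        filter_upwards [Lp.coeFn_sub u (Lp.const (ENNReal.ofReal p) μ c),
          Lp.coeFn_const (ENNReal.ofReal p) μ c] with x h1 h2
        rw [h1, Pi.sub_apply, h2, Function.const_apply, Real.norm_eq_abs]

theorem lpOsc_eq_norm_lpModConst_rpow (u : Lp ℝ (ENNReal.ofReal p) μ) :
    lpOsc μ p u = ‖lpModConst μ p u‖ ^ p := by
  have hp0 : 0 < p := one_pos.trans hp.out
  refine le_antisymm ?_ (le_ciInf fun c => norm_lpModConst_rpow_le u c)
  have key : ∀ δ : ℝ, 0 < δ → lpOsc μ p u ≤ (‖lpModConst μ p u‖ + δ) ^ p := by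
    intro δ hδ
    obtain ⟨w, hw, hwn⟩ := Submodule.Quotient.norm_mk_lt (lpModConst μ p u) hδ
    obtain ⟨c, hc⟩ : u - w ∈ lpConstants μ p := (Submodule.Quotient.eq _).1 hw.symm
    have hw' : w = u - Lp.const (ENNReal.ofReal p) μ c := by
      have hc' : Lp.const (ENNReal.ofReal p) μ c = u - w := hc
      rw [hc', sub_sub_cancel]
    refine (lpOsc_le p u c).trans (le_trans (le_of_eq ?_)
      (Real.rpow_le_rpow (norm_nonneg w) hwn.le hp0.le))
    rw [norm_rpow_Lp_eq_integral hp0, hw']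
    refine integral_congr_ae ?_
    filter_upwards [Lp.coeFn_sub u (Lp.const (ENNReal.ofReal p) μ c),
      Lp.coeFn_const (ENNReal.ofReal p) μ c] with x h1 h2
    rw [h1, Pi.sub_apply, h2, Function.const_apply, Real.norm_eq_abs]
  have hlim : Tendsto (fun δ : ℝ => (‖lpModConst μ p u‖ + δ) ^ p) (𝓝[>] 0)
      (𝓝 ((‖lpModConst μ p u‖ + 0) ^ p)) :=
    (((continuous_const.add continuous_id).rpow_const fun _ => Or.inr hp0.le).tendsto 0).mono_left
      nhdsWithin_le_nhds
  rw [add_zero] at hlim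
  exact ge_of_tendsto hlim (by filter_upwards [self_mem_nhdsWithin] with δ hδ using key δ hδ)

theorem continuous_lpOsc : Continuous fun u : Lp ℝ (ENNReal.ofReal p) μ => lpOsc μ p u := by
  have hp0 : 0 < p := one_pos.trans hp.out
  simp only [lpOsc_eq_norm_lpModConst_rpow]
  exact (lpModConst μ p).continuous.norm.rpow_const fun _ => Or.inr hp0.le

theorem tendsto_lpOsc_of_bounded_ae {u : ℕ → α → ℝ} {v : α → ℝ} {R : ℝ}
    (hu : ∀ n, AEStronglyMeasurable (u n) μ) (hv : AEStronglyMeasurable v μ)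
    (hR : ∀ n, ∀ᵐ x ∂μ, |u n x| ≤ R) (hvR : ∀ᵐ x ∂μ, |v x| ≤ R)
    (h : ∀ᵐ x ∂μ, Tendsto (fun n => u n x) atTop (𝓝 (v x))) :
    Tendsto (fun n => lpOsc μ p (u n)) atTop (𝓝 (lpOsc μ p v)) := by
  have hp0 : 0 < p := one_pos.trans hp.out
  have hun : ∀ n, MemLp (u n) (ENNReal.ofReal p) μ := fun n => MemLp.of_bound (hu n) R (hR n)
  have hvn : MemLp v (ENNReal.ofReal p) μ := MemLp.of_bound hv R hvR
  have hT : Tendsto (fun n => (hun n).toLp (u n)) atTop (𝓝 (hvn.toLp v)) := by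
    rw [tendsto_iff_norm_sub_tendsto_zero]
    have hI : Tendsto (fun n => ∫ x, |u n x - v x| ^ p ∂μ) atTop (𝓝 (∫ x, (0 : ℝ) ∂μ)) := by
      refine tendsto_integral_of_dominated_convergence (fun _ => (2 * R) ^ p) ?_
        (integrable_const _) ?_ ?_
      · intro n
        exact (((hu n).sub hv).norm.aemeasurable.pow_const p).aestronglyMeasurable
      · intro n
        filter_upwards [hR n, hvR] with x h1 h2
        rw [Real.norm_of_nonneg (by positivity)]
        refine Real.rpow_le_rpow (abs_nonneg _) ?_ hp0.le
        exact (abs_sub _ _).trans (by linarith)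
      · filter_upwards [h] with x hx
        have := ((hx.sub_const (v x)).abs).rpow_const (p := p) (Or.inr hp0.le)
        simpa [Real.zero_rpow hp0.ne'] using this
    have h2 := hI.rpow_const (p := p⁻¹) (Or.inr (by positivity))
    rw [integral_zero, Real.zero_rpow (by positivity)] at h2
    refine h2.congr fun n => ?_
    rw [← MemLp.toLp_sub, ← Real.rpow_rpow_inv (norm_nonneg _) hp0.ne',
      norm_rpow_Lp_eq_integral hp0]
    congr 1
    refine integral_congr_ae ?_
    filter_upwards [((hun n).sub hvn).coeFn_toLp] with x hx
    rw [hx, Real.norm_eq_abs, Pi.sub_apply]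
  have := (continuous_lpOsc (μ := μ) (p := p)).continuousAt.tendsto.comp hT
  refine (this.congr fun n => ?_).trans_eq ?_
  · exact lpOsc_congr (hun n).coeFn_toLp
  · rw [lpOsc_congr hvn.coeFn_toLp]

end Oscillation

/-! ### The lower bound for the Γ-limit -/

section LowerBound

theorem WeaklyTendsto.tendsto_apply {X : Type*} [NormedAddCommGroup X] [NormedSpace ℝ X]
    {us : ℕ → X} {u : X} (h : WeaklyTendsto us u) (l : X →L[ℝ] ℝ) :
    Tendsto (fun k => l (us k)) atTop (𝓝 (l u)) :=
  ((WeakBilin.eval_continuous (topDualPairing ℝ X).flip l).tendsto _).comp h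

theorem Filter.Tendsto.weaklyTendsto {X : Type*} [NormedAddCommGroup X] [NormedSpace ℝ X]
    {us : ℕ → X} {u : X} (h : Tendsto us atTop (𝓝 u)) : WeaklyTendsto us u :=
  ((toWeakSpaceCLM ℝ X).continuous.tendsto u).comp h

variable {d : ℕ} {Ω : Opens (EuclideanSpace ℝ (Fin d))} {p : ℝ} [hp : Fact (1 < p)]

variable (Ω p) in
/-- `w0Val` as a continuous linear map. -/
def w0ValL : W0 Ω p →L[ℝ] Lp ℝ (ENNReal.ofReal p)
    (volume.restrict (Ω : Set (EuclideanSpace ℝ (Fin d)))) :=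
  (ContinuousLinearMap.fst ℝ _ _).comp (W0 Ω p).subtypeL

variable (Ω p) in
/-- `w0Grad` as a continuous linear map. -/
def w0GradL : W0 Ω p →L[ℝ] Lp (EuclideanSpace ℝ (Fin d)) (ENNReal.ofReal p)
    (volume.restrict (Ω : Set (EuclideanSpace ℝ (Fin d)))) :=
  (ContinuousLinearMap.snd ℝ _ _).comp (W0 Ω p).subtypeL

variable [IsFiniteMeasure (volume.restrict (Ω : Set (EuclideanSpace ℝ (Fin d))))]

/-- For each fixed `y`, the function `x ↦ |u(x) - u(y)|^p` integrates to at least the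
`p`-th power of the distance from `u` to the constants; averaging over `y` keeps this bound. -/
theorem add_rpow_le_ballEnergy {r : ℝ} (hr : 0 < r)
    (hrΩ : Metric.ball (0 : EuclideanSpace ℝ (Fin d)) r ⊆ Ω) (u : W0 Ω p) :
    ‖lpModConst (volume.restrict (Ω : Set (EuclideanSpace ℝ (Fin d)))) p (w0Val u)‖ ^ p +
      ‖w0Grad u‖ ^ p ≤ ballEnergy r u := by
  have hp0 : 0 < p := one_pos.trans hp.out
  have h0 : ENNReal.ofReal p ≠ 0 := by simpa using hp0
  unfold ballEnergy
  rw [norm_rpow_Lp_eq_integral hp0 (w0Grad u)]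
  refine add_le_add_left ?_ _
  set D := ‖lpModConst (volume.restrict (Ω : Set (EuclideanSpace ℝ (Fin d)))) p (w0Val u)‖ ^ p
  rw [Set.inter_eq_left.2 hrΩ]
  set B := Metric.ball (0 : EuclideanSpace ℝ (Fin d)) r
  set μ := volume.restrict (Ω : Set (EuclideanSpace ℝ (Fin d)))
  have hBpos : 0 < volume.real B :=
    ENNReal.toReal_pos (Metric.measure_ball_pos volume _ hr).ne' measure_ball_lt_top.ne
  have hle : volume.restrict B ≤ μ := Measure.restrict_mono hrΩ le_rfl
  have : IsFiniteMeasure (volume.restrict B) := isFiniteMeasure_of_le μ hle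
  have hu := Lp.memLp (w0Val u)
  have hint : Integrable (Function.uncurry fun x y => |w0Val u x - w0Val u y| ^ p)
      (μ.prod (volume.restrict B)) := by
    have h1 := ((hu.comp_fst (volume.restrict B)).sub
      ((hu.mono_measure hle).comp_snd μ)).integrable_norm_rpow h0 ENNReal.ofReal_ne_top
    rw [ENNReal.toReal_ofReal hp0.le] at h1
    exact h1
  rw [integral_integral_swap hint, inv_mul_eq_div, le_div_iff₀ hBpos]
  calc D * volume.real B = ∫ y in B, D := by
        rw [setIntegral_const, smul_eq_mul, mul_comm]
    _ ≤ _ := by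
        refine integral_mono (integrable_const _) hint.integral_prod_right fun y => ?_
        exact norm_lpModConst_rpow_le (w0Val u) (w0Val u y)

/-- The distance to the constants and the norm of the gradient are attained by continuous
functionals of norm at most one, so they are weakly lower semicontinuous. -/
theorem lpOsc_add_le_of_isWeakGammaLimit (hΩ0 : (0 : EuclideanSpace ℝ (Fin d)) ∈ Ω)
    {ε : ℕ → ℝ} (hεpos : ∀ k, 0 < ε k) (hεlim : Tendsto ε atTop (𝓝 0)) {F : W0 Ω p → EReal}
    (hF : IsWeakGammaLimit (fun k (u : W0 Ω p) => ((ballEnergy (ε k) u : ℝ) : EReal)) F)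
    (u : W0 Ω p) :
    ((lpOsc (volume.restrict (Ω : Set (EuclideanSpace ℝ (Fin d)))) p (w0Val u) +
      ∫ x in (Ω : Set (EuclideanSpace ℝ (Fin d))), ‖w0Grad u x‖ ^ p : ℝ) : EReal) ≤ F u := by
  have hp0 : 0 < p := one_pos.trans hp.out
  set μ := volume.restrict (Ω : Set (EuclideanSpace ℝ (Fin d)))
  obtain ⟨us, hus, hlim⟩ := hF.2 u
  refine le_trans ?_ hlim
  obtain ⟨l₁, hl₁, hl₁u⟩ := exists_dual_vector'' ℝ (lpModConst μ p (w0Val u))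
  obtain ⟨l₂, hl₂, hl₂u⟩ := exists_dual_vector'' ℝ (w0Grad u)
  have t₁ : Tendsto (fun k => |l₁ (lpModConst μ p (w0Val (us k)))| ^ p) atTop
      (𝓝 (lpOsc μ p (w0Val u))) := by
    have h : Tendsto (fun k => l₁ (lpModConst μ p (w0Val (us k)))) atTop
        (𝓝 (l₁ (lpModConst μ p (w0Val u)))) :=
      hus.tendsto_apply (l₁.comp ((lpModConst μ p).comp (w0ValL Ω p)))
    rw [hl₁u] at h
    have h' := h.abs.rpow_const (p := p) (Or.inr hp0.le)
    simp only [RCLike.ofReal_real_eq_id, id, abs_norm] at h'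
    rwa [lpOsc_eq_norm_lpModConst_rpow]
  have t₂ : Tendsto (fun k => |l₂ (w0Grad (us k))| ^ p) atTop
      (𝓝 (∫ x, ‖w0Grad u x‖ ^ p ∂μ)) := by
    have h : Tendsto (fun k => l₂ (w0Grad (us k))) atTop (𝓝 (l₂ (w0Grad u))) :=
      hus.tendsto_apply (l₂.comp (w0GradL Ω p))
    rw [hl₂u] at h
    have h' := h.abs.rpow_const (p := p) (Or.inr hp0.le)
    simp only [RCLike.ofReal_real_eq_id, id, abs_norm] at h'
    rwa [← norm_rpow_Lp_eq_integral hp0]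
  have t := t₁.add t₂
  have t' := (continuous_coe_real_ereal.tendsto _).comp t
  rw [← t'.limsup_eq]
  refine limsup_le_limsup ?_
  filter_upwards [hεlim.eventually (eventually_ball_subset (Ω.isOpen.mem_nhds hΩ0))] with k hk
  refine EReal.coe_le_coe_iff.2 (le_trans ?_ (add_rpow_le_ballEnergy (hεpos k) hk (us k)))
  refine add_le_add (Real.rpow_le_rpow (abs_nonneg _) ?_ hp0.le)
    (Real.rpow_le_rpow (abs_nonneg _) ?_ hp0.le)
  · exact (l₁.le_opNorm _).trans (mul_le_of_le_one_left (norm_nonneg _) hl₁)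
  · exact (l₂.le_opNorm _).trans (mul_le_of_le_one_left (norm_nonneg _) hl₂)

end LowerBound

/-! ### Cutoff functions of small `W^{1,p}` energy -/

section Cutoff

theorem Finset.sum_rpow_of_pairwise_eq_zero {ι : Type*} (s : Finset ι) (a : ι → ℝ) {p : ℝ}
    (hp : 0 < p) (h : ∀ i ∈ s, ∀ j ∈ s, a i ≠ 0 → a j ≠ 0 → i = j) :
    (∑ i ∈ s, a i) ^ p = ∑ i ∈ s, a i ^ p := by
  by_cases hex : ∃ i ∈ s, a i ≠ 0
  · obtain ⟨i, hi, hai⟩ := hex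
    have h0 : ∀ j ∈ s, j ≠ i → a j = 0 := fun j hj hji => by
      by_contra hne
      exact hji (h j hj i hi hne hai)
    rw [Finset.sum_eq_single_of_mem i hi h0, Finset.sum_eq_single_of_mem i hi]
    intro j hj hji
    rw [h0 j hj hji, Real.zero_rpow hp.ne']
  · push Not at hex
    rw [Finset.sum_eq_zero hex, Real.zero_rpow hp.ne', Finset.sum_eq_zero]
    intro i hi
    rw [hex i hi, Real.zero_rpow hp.ne']

variable (d : ℕ)

/-- The bump `χ`: a smooth function equal to `1` on the unit ball and supported in the ball of radius `2`. -/
def unitBump : ContDiffBump (0 : EuclideanSpace ℝ (Fin d)) := ⟨1, 2, one_pos, one_lt_two⟩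

/-- The average of the bumps `x ↦ χ(3^j x)` for `N ≤ j < 2N`, where `χ` is `unitBump`. The
gradients of the summands live on pairwise disjoint annuli. -/
def multiscaleCutoff (N : ℕ) (x : EuclideanSpace ℝ (Fin d)) : ℝ :=
  (N : ℝ)⁻¹ * ∑ j ∈ Finset.Ico N (2 * N), unitBump d ((3 : ℝ) ^ j • x)

variable {d}

theorem contDiff_multiscaleCutoff (N : ℕ) : ContDiff ℝ ∞ (multiscaleCutoff d N) := by
  unfold multiscaleCutoff
  refine contDiff_const.mul (ContDiff.sum fun j _ => ?_)
  exact (unitBump d).contDiff.comp (contDiff_const_smul _)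

theorem multiscaleCutoff_nonneg (N : ℕ) (x : EuclideanSpace ℝ (Fin d)) :
    0 ≤ multiscaleCutoff d N x :=
  mul_nonneg (by positivity) (Finset.sum_nonneg fun _ _ => (unitBump d).nonneg)

theorem multiscaleCutoff_le_one (N : ℕ) (x : EuclideanSpace ℝ (Fin d)) :
    multiscaleCutoff d N x ≤ 1 := by
  unfold multiscaleCutoff
  have h : ∑ j ∈ Finset.Ico N (2 * N), unitBump d ((3 : ℝ) ^ j • x) ≤ N := by
    refine (Finset.sum_le_card_nsmul _ _ 1 fun _ _ => (unitBump d).le_one).trans ?_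
    rw [Nat.card_Ico, nsmul_one]
    exact_mod_cast (by lia : 2 * N - N ≤ N)
  calc (N : ℝ)⁻¹ * _ ≤ (N : ℝ)⁻¹ * N := by gcongr
    _ ≤ 1 := inv_mul_le_one

theorem multiscaleCutoff_eq_one {N : ℕ} (hN : 0 < N) {x : EuclideanSpace ℝ (Fin d)}
    (hx : ‖x‖ ≤ ((3 : ℝ) ^ (2 * N))⁻¹) : multiscaleCutoff d N x = 1 := by
  unfold multiscaleCutoff
  rw [Finset.sum_congr rfl (g := fun _ => (1 : ℝ))]
  · rw [Finset.sum_const, Nat.card_Ico, nsmul_one, show 2 * N - N = N by lia,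
      inv_mul_cancel₀ (by positivity)]
  · intro j hj
    refine (unitBump d).one_of_mem_closedBall ?_
    rw [mem_closedBall_zero_iff, norm_smul, Real.norm_of_nonneg (by positivity)]
    calc (3 : ℝ) ^ j * ‖x‖ ≤ (3 : ℝ) ^ (2 * N) * ((3 : ℝ) ^ (2 * N))⁻¹ := by
          gcongr
          · norm_num
          · exact (Finset.mem_Ico.1 hj).2.le
      _ = 1 := mul_inv_cancel₀ (by positivity)

theorem multiscaleCutoff_eq_zero {N : ℕ} {x : EuclideanSpace ℝ (Fin d)}
    (hx : 2 * ((3 : ℝ) ^ N)⁻¹ ≤ ‖x‖) : multiscaleCutoff d N x = 0 := by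
  unfold multiscaleCutoff
  rw [Finset.sum_eq_zero, mul_zero]
  intro j hj
  refine (unitBump d).zero_of_le_dist ?_
  rw [dist_zero_right, norm_smul, Real.norm_of_nonneg (by positivity)]
  calc (2 : ℝ) = 3 ^ N * (2 * ((3 : ℝ) ^ N)⁻¹) := by field_simp
    _ ≤ 3 ^ j * ‖x‖ := by
        gcongr
        · norm_num
        · exact (Finset.mem_Ico.1 hj).1

theorem support_multiscaleCutoff_subset (N : ℕ) :
    Function.support (multiscaleCutoff d N) ⊆ Metric.closedBall 0 (2 * ((3 : ℝ) ^ N)⁻¹) := by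
  intro x hx
  rw [mem_closedBall_zero_iff]
  by_contra h
  exact hx (multiscaleCutoff_eq_zero (not_le.1 h).le)

/-- The annulus `1 ≤ 3^j |x| ≤ 2`. -/
def ternaryAnnulus (d j : ℕ) : Set (EuclideanSpace ℝ (Fin d)) :=
  {x | 1 ≤ (3 : ℝ) ^ j * ‖x‖ ∧ (3 : ℝ) ^ j * ‖x‖ ≤ 2}

theorem eq_of_mem_ternaryAnnulus {i j : ℕ} {x : EuclideanSpace ℝ (Fin d)}
    (hi : x ∈ ternaryAnnulus d i) (hj : x ∈ ternaryAnnulus d j) : i = j := by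
  have key : ∀ i j : ℕ, x ∈ ternaryAnnulus d i → x ∈ ternaryAnnulus d j → ¬ i < j := by
    intro i j hi hj hij
    have h1 : (3 : ℝ) ^ (i + 1) * ‖x‖ ≤ 3 ^ j * ‖x‖ := by
      gcongr
      · norm_num
      · exact hij
    rw [pow_succ] at h1
    linarith [hi.1, hj.2]
  exact le_antisymm (not_lt.1 (key j i hj hi)) (not_lt.1 (key i j hi hj))

theorem measurableSet_ternaryAnnulus (j : ℕ) : MeasurableSet (ternaryAnnulus d j) := by
  have h : Measurable fun x : EuclideanSpace ℝ (Fin d) => (3 : ℝ) ^ j * ‖x‖ := by fun_prop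
  exact (measurableSet_le measurable_const h).inter (measurableSet_le h measurable_const)

theorem ternaryAnnulus_subset (j : ℕ) :
    ternaryAnnulus d j ⊆ Metric.closedBall 0 (2 * ((3 : ℝ) ^ j)⁻¹) := by
  intro x hx
  rw [mem_closedBall_zero_iff, ← div_eq_mul_inv, le_div_iff₀ (by positivity), mul_comm]
  exact hx.2

theorem exists_norm_fderiv_unitBump_le :
    ∃ D : ℝ, 0 ≤ D ∧ ∀ x, ‖fderiv ℝ (unitBump d) x‖ ≤ D := by
  obtain ⟨D, hD⟩ := ((unitBump d).contDiff.continuous_fderiv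
    (n := 1) one_ne_zero).bounded_above_of_compact_support ((unitBump d).hasCompactSupport.fderiv ℝ)
  exact ⟨D, (norm_nonneg _).trans (hD 0), hD⟩

theorem fderiv_unitBump_eq_zero {x : EuclideanSpace ℝ (Fin d)} (hx : ¬ (1 ≤ ‖x‖ ∧ ‖x‖ ≤ 2)) :
    fderiv ℝ (unitBump d) x = 0 := by
  by_cases h1 : 1 ≤ ‖x‖
  · have h2 : x ∉ tsupport (unitBump d) := by
      rw [ContDiffBump.tsupport_eq, mem_closedBall_zero_iff]
      exact fun h => hx ⟨h1, h⟩
    exact image_eq_zero_of_notMem_tsupport fun h => h2 (tsupport_fderiv_subset ℝ h)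
  · have : (unitBump d : EuclideanSpace ℝ (Fin d) → ℝ) =ᶠ[𝓝 x] fun _ => (1 : ℝ) :=
      (unitBump d).eventuallyEq_one_of_mem_ball (by simpa [unitBump] using h1)
    rw [this.fderiv_eq, fderiv_fun_const, Pi.zero_apply]

theorem norm_fderiv_multiscaleCutoff_le {D : ℝ}
    (hD : ∀ x, ‖fderiv ℝ (unitBump d) x‖ ≤ D) (N : ℕ) (x : EuclideanSpace ℝ (Fin d)) :
    ‖fderiv ℝ (multiscaleCutoff d N) x‖ ≤
      ∑ j ∈ Finset.Ico N (2 * N),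
        (ternaryAnnulus d j).indicator (fun _ => (N : ℝ)⁻¹ * (3 ^ j * D)) x := by
  have hdiff : ∀ j : ℕ, DifferentiableAt ℝ (fun x => unitBump d ((3 : ℝ) ^ j • x)) x := fun j =>
    ((unitBump d).contDiff.comp (contDiff_const_smul ((3 : ℝ) ^ j))).differentiable
      (n := 1) one_ne_zero x
  have h1 : fderiv ℝ (multiscaleCutoff d N) x =
      (N : ℝ)⁻¹ • ∑ j ∈ Finset.Ico N (2 * N),
        (3 : ℝ) ^ j • fderiv ℝ (unitBump d) ((3 : ℝ) ^ j • x) := by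
    unfold multiscaleCutoff
    rw [fderiv_const_mul (DifferentiableAt.fun_sum fun j _ => hdiff j),
      fderiv_fun_sum fun j _ => hdiff j]
    congr 1
    exact Finset.sum_congr rfl fun j _ => fderiv_comp_smul _
  rw [h1, Finset.smul_sum]
  refine (norm_sum_le _ _).trans (Finset.sum_le_sum fun j _ => ?_)
  rw [norm_smul, norm_smul, Real.norm_of_nonneg (by positivity),
    Real.norm_of_nonneg (by positivity)]
  by_cases hx : x ∈ ternaryAnnulus d j
  · rw [Set.indicator_of_mem hx]
    gcongr
    exact hD _
  · rw [Set.indicator_of_notMem hx, fderiv_unitBump_eq_zero, norm_zero, mul_zero, mul_zero]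
    rwa [norm_smul, Real.norm_of_nonneg (by positivity)]

/-- Since `p ≤ d`, every annulus contributes a bounded amount to `∫ |∇η|^p`, and there are `N` of
them with weight `N^{-p}`. -/
theorem exists_integral_norm_fderiv_multiscaleCutoff_le {p : ℝ} (hp : 1 < p) (hpd : p ≤ d) :
    ∃ C : ℝ, ∀ N : ℕ, 0 < N →
      Integrable (fun x => ‖fderiv ℝ (multiscaleCutoff d N) x‖ ^ p) ∧
      ∫ x, ‖fderiv ℝ (multiscaleCutoff d N) x‖ ^ p ≤ C * (N : ℝ) ^ (1 - p) := by
  have hp0 : 0 < p := one_pos.trans hp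
  obtain ⟨D, hD0, hD⟩ := exists_norm_fderiv_unitBump_le (d := d)
  set V := volume.real (Metric.closedBall (0 : EuclideanSpace ℝ (Fin d)) 1)
  refine ⟨D ^ p * 2 ^ d * V, fun N hN => ?_⟩
  have hNpos : (0 : ℝ) < N := by exact_mod_cast hN
  have hvol : ∀ j : ℕ, volume (ternaryAnnulus d j) ≠ ⊤ := fun j =>
    ((measure_mono (ternaryAnnulus_subset j)).trans_lt measure_closedBall_lt_top).ne
  have hint : ∀ j : ℕ, Integrable ((ternaryAnnulus d j).indicator
      fun _ => ((N : ℝ)⁻¹ * (3 ^ j * D)) ^ p) := fun j =>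
    (integrable_indicator_iff (measurableSet_ternaryAnnulus j)).2
      (integrableOn_const (hvol j))
  have hpt : ∀ x, ‖fderiv ℝ (multiscaleCutoff d N) x‖ ^ p ≤
      ∑ j ∈ Finset.Ico N (2 * N),
        (ternaryAnnulus d j).indicator (fun _ => ((N : ℝ)⁻¹ * (3 ^ j * D)) ^ p) x := by
    intro x
    refine (Real.rpow_le_rpow (norm_nonneg _) (norm_fderiv_multiscaleCutoff_le hD N x)
      hp0.le).trans_eq ?_
    rw [Finset.sum_rpow_of_pairwise_eq_zero _ _ hp0]
    · refine Finset.sum_congr rfl fun j _ => ?_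
      by_cases hx : x ∈ ternaryAnnulus d j
      · rw [Set.indicator_of_mem hx, Set.indicator_of_mem hx]
      · rw [Set.indicator_of_notMem hx, Set.indicator_of_notMem hx, Real.zero_rpow hp0.ne']
    · intro i _ j _ hi hj
      exact eq_of_mem_ternaryAnnulus (Set.mem_of_indicator_ne_zero hi)
        (Set.mem_of_indicator_ne_zero hj)
  have hsum := integrable_finsetSum (Finset.Ico N (2 * N)) fun j _ => hint j
  constructor
  · refine hsum.mono' (Measurable.aestronglyMeasurable ?_) (ae_of_all _ fun x => ?_)
    · exact (((contDiff_multiscaleCutoff N).continuous_fderiv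
        (by simp)).norm.rpow_const fun _ => Or.inr hp0.le).measurable
    · rw [Real.norm_of_nonneg (by positivity)]
      exact hpt x
  refine (integral_mono_of_nonneg (ae_of_all _ fun x => by positivity) hsum
    (ae_of_all _ hpt)).trans ?_
  rw [integral_finsetSum _ fun j _ => hint j]
  have hterm : ∀ j ∈ Finset.Ico N (2 * N),
      ∫ x, (ternaryAnnulus d j).indicator (fun _ => ((N : ℝ)⁻¹ * (3 ^ j * D)) ^ p) x ≤
        (N : ℝ) ^ (-p) * (D ^ p * 2 ^ d * V) := by
    intro j _
    have h3 : (0 : ℝ) < 3 ^ j := by positivity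
    rw [integral_indicator_const _ (measurableSet_ternaryAnnulus j), smul_eq_mul]
    have hv : volume.real (ternaryAnnulus d j) ≤ (2 * ((3 : ℝ) ^ j)⁻¹) ^ d * V := by
      refine (measureReal_mono (ternaryAnnulus_subset j) measure_closedBall_lt_top.ne).trans_eq ?_
      rw [Measure.addHaar_real_closedBall' _ _ (by positivity), finrank_euclideanSpace_fin]
    -- the factor `3^(j(p - d))` in `∫ |∇(χ(3^j x))|^p` is bounded because `p ≤ d`
    have h4 : ((3 : ℝ) ^ j) ^ p ≤ ((3 : ℝ) ^ j) ^ d := by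
      rw [← Real.rpow_natCast _ d]
      exact Real.rpow_le_rpow_of_exponent_le (one_le_pow₀ (by norm_num)) hpd
    calc _ ≤ (2 * ((3 : ℝ) ^ j)⁻¹) ^ d * V * ((N : ℝ)⁻¹ * (3 ^ j * D)) ^ p := by gcongr
      _ = (N : ℝ) ^ (-p) * (D ^ p * 2 ^ d * V) * (((3 : ℝ) ^ j) ^ p / ((3 : ℝ) ^ j) ^ d) := by
          rw [Real.mul_rpow (by positivity) (by positivity), Real.mul_rpow h3.le hD0,
            Real.inv_rpow hNpos.le, Real.rpow_neg hNpos.le, mul_pow, inv_pow]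
          ring
      _ ≤ (N : ℝ) ^ (-p) * (D ^ p * 2 ^ d * V) * 1 := by
          gcongr
          exact (div_le_one (by positivity)).2 h4
      _ = _ := mul_one _
  refine (Finset.sum_le_card_nsmul _ _ _ hterm).trans_eq ?_
  rw [Nat.card_Ico, show 2 * N - N = N by lia, nsmul_eq_mul, sub_eq_add_neg,
    Real.rpow_add hNpos, Real.rpow_one]
  ring

end Cutoff

/-! ### The upper bound and the value of the Γ-limit on test functions -/

section UpperBound

variable {d : ℕ} {Ω : Opens (EuclideanSpace ℝ (Fin d))} {p : ℝ} [hp : Fact (1 < p)]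

theorem norm_gradient_eq_norm_fderiv (φ : EuclideanSpace ℝ (Fin d) → ℝ)
    (x : EuclideanSpace ℝ (Fin d)) : ‖∇ φ x‖ = ‖fderiv ℝ φ x‖ :=
  LinearIsometryEquiv.norm_map _ _

theorem w0Val_testToW0 (φ : 𝓓(Ω, ℝ)) :
    w0Val (testToW0 Ω p φ) =ᵐ[volume.restrict (Ω : Set (EuclideanSpace ℝ (Fin d)))] φ :=
  (φ.memLp_self p).coeFn_toLp

theorem w0Grad_testToW0 (φ : 𝓓(Ω, ℝ)) :
    w0Grad (testToW0 Ω p φ) =ᵐ[volume.restrict (Ω : Set (EuclideanSpace ℝ (Fin d)))] ∇ φ :=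
  (φ.memLp_gradient p).coeFn_toLp

theorem integral_norm_w0Grad_testToW0 (φ : 𝓓(Ω, ℝ)) :
    ∫ x in (Ω : Set (EuclideanSpace ℝ (Fin d))), ‖w0Grad (testToW0 Ω p φ) x‖ ^ p =
      ∫ x in (Ω : Set (EuclideanSpace ℝ (Fin d))), ‖∇ φ x‖ ^ p := by
  refine integral_congr_ae ?_
  filter_upwards [w0Grad_testToW0 (p := p) φ] with x hx
  rw [hx]

/-- On a function equal to `c` on the ball of radius `r`, the nonlocal term is exactly
`∫ |ψ - c|^p`. -/
theorem ballEnergy_testToW0_of_eq_const {ψ : 𝓓(Ω, ℝ)} {c r ρ : ℝ} (hr : 0 < r) (hrρ : r ≤ ρ)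
    (hrΩ : Metric.ball (0 : EuclideanSpace ℝ (Fin d)) r ⊆ Ω)
    (hψ : ∀ x, ‖x‖ < ρ → ψ x = c) :
    ballEnergy r (testToW0 Ω p ψ) =
      (∫ x in (Ω : Set (EuclideanSpace ℝ (Fin d))), |w0Val (testToW0 Ω p ψ) x - c| ^ p) +
        ∫ x in (Ω : Set (EuclideanSpace ℝ (Fin d))), ‖w0Grad (testToW0 Ω p ψ) x‖ ^ p := by
  unfold ballEnergy
  rw [Set.inter_eq_left.2 hrΩ]
  set B := Metric.ball (0 : EuclideanSpace ℝ (Fin d)) r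
  have hBpos : 0 < volume.real B :=
    ENNReal.toReal_pos (Metric.measure_ball_pos volume _ hr).ne' measure_ball_lt_top.ne
  have hae : ∀ᵐ y ∂volume.restrict B, w0Val (testToW0 Ω p ψ) y = c := by
    filter_upwards [ae_mono (Measure.restrict_mono hrΩ le_rfl) (w0Val_testToW0 (p := p) ψ),
      ae_restrict_mem Metric.isOpen_ball.measurableSet] with y hy hyB
    rw [hy]
    exact hψ y ((mem_ball_zero_iff.1 hyB).trans_le hrρ)
  have hin : ∀ x, ∫ y in B, |w0Val (testToW0 Ω p ψ) x - w0Val (testToW0 Ω p ψ) y| ^ p =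
      volume.real B * |w0Val (testToW0 Ω p ψ) x - c| ^ p := by
    intro x
    rw [← smul_eq_mul, ← setIntegral_const]
    refine integral_congr_ae ?_
    filter_upwards [hae] with y hy
    rw [hy]
  simp only [hin]
  rw [integral_const_mul, inv_mul_cancel_left₀ hBpos.ne']

/-- A diagonal sequence along which a family of eventual properties holds. -/
theorem exists_tendsto_atTop_eventually {P : ℕ → ℕ → Prop} (h : ∀ j, ∀ᶠ k in atTop, P j k) :
    ∃ j : ℕ → ℕ, Tendsto j atTop atTop ∧ ∀ᶠ k in atTop, P (j k) k := by
  classical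
  refine ⟨fun k => Nat.findGreatest (fun j => P j k) k, ?_, ?_⟩
  · rw [tendsto_atTop]
    intro J
    filter_upwards [h J, eventually_ge_atTop J] with k hk hJk
    exact Nat.le_findGreatest hJk hk
  · filter_upwards [h 0] with k hk
    exact Nat.findGreatest_spec (P := fun j => P j k) (Nat.zero_le k) hk

/-- The modification of `φ` by the test function `(c - φ) η`, for `η` a multiscale cutoff. -/
def cutoffTest (φ : 𝓓(Ω, ℝ)) (c : ℝ) {N : ℕ}
    (hN : Metric.closedBall (0 : EuclideanSpace ℝ (Fin d)) (2 * ((3 : ℝ) ^ N)⁻¹) ⊆ Ω) :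
    𝓓(Ω, ℝ) where
  toFun x := (c - φ x) * multiscaleCutoff d N x
  contDiff' := (contDiff_const.sub φ.contDiff).mul (contDiff_multiscaleCutoff N)
  hasCompactSupport' := HasCompactSupport.of_support_subset_isCompact
    (isCompact_closedBall 0 (2 * ((3 : ℝ) ^ N)⁻¹))
    ((Function.support_mul_subset_right _ _).trans (support_multiscaleCutoff_subset N))
  tsupport_subset' := (closure_minimal ((Function.support_mul_subset_right _ _).trans
    (support_multiscaleCutoff_subset N)) Metric.isClosed_closedBall).trans hN

theorem TestFunction.exists_bound (φ : 𝓓(Ω, ℝ)) :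
    ∃ K : ℝ, 0 ≤ K ∧ (∀ x, |φ x| ≤ K) ∧ ∀ x, ‖fderiv ℝ φ x‖ ≤ K := by
  obtain ⟨K₁, h₁⟩ := φ.continuous.bounded_above_of_compact_support φ.hasCompactSupport
  obtain ⟨K₂, h₂⟩ := (φ.contDiff.continuous_fderiv
    (by simp)).bounded_above_of_compact_support (φ.hasCompactSupport.fderiv ℝ)
  refine ⟨max K₁ K₂, ((norm_nonneg _).trans (h₁ 0)).trans (le_max_left _ _),
    fun x => (h₁ x).trans (le_max_left _ _), fun x => (h₂ x).trans (le_max_right _ _)⟩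

theorem norm_fderiv_cutoffTest_le {φ : 𝓓(Ω, ℝ)} {c K : ℝ} {N : ℕ}
    (hN : Metric.closedBall (0 : EuclideanSpace ℝ (Fin d)) (2 * ((3 : ℝ) ^ N)⁻¹) ⊆ Ω)
    (hφ : ∀ x, |c - φ x| ≤ K) (hφ' : ∀ x, ‖fderiv ℝ φ x‖ ≤ K)
    (x : EuclideanSpace ℝ (Fin d)) :
    ‖fderiv ℝ (cutoffTest φ c hN) x‖ ≤
      K * (‖fderiv ℝ (multiscaleCutoff d N) x‖ + multiscaleCutoff d N x) := by
  have hη := (contDiff_multiscaleCutoff (d := d) N).differentiable (by simp) x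
  have h1 : fderiv ℝ (cutoffTest φ c hN) x =
      (c - φ x) • fderiv ℝ (multiscaleCutoff d N) x +
        multiscaleCutoff d N x • (-fderiv ℝ φ x) := by
    have h2 : fderiv ℝ (cutoffTest φ c hN) x =
      fderiv ℝ (fun x => (c - φ x) * multiscaleCutoff d N x) x := rfl
    rw [h2, fderiv_fun_mul ((φ.differentiable' x).const_sub c) hη, fderiv_const_sub]
  rw [h1, mul_add]
  refine (norm_add_le _ _).trans (add_le_add ?_ ?_)
  · rw [norm_smul]
    gcongr
    exact hφ x
  · rw [norm_smul, norm_neg, Real.norm_of_nonneg (multiscaleCutoff_nonneg N x), mul_comm]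
    gcongr
    · exact multiscaleCutoff_nonneg N x
    · exact hφ' x

theorem tendsto_volume_closedBall_shrink (hd : d ≠ 0) :
    Tendsto (fun N : ℕ => volume.real
      (Metric.closedBall (0 : EuclideanSpace ℝ (Fin d)) (2 * ((3 : ℝ) ^ N)⁻¹))) atTop (𝓝 0) := by
  have h1 : Tendsto (fun N : ℕ => (2 * ((3 : ℝ) ^ N)⁻¹)) atTop (𝓝 0) := by
    have := (tendsto_pow_atTop_nhds_zero_of_lt_one (r := (3 : ℝ)⁻¹) (by positivity)
      (by norm_num)).const_mul 2
    simpa only [inv_pow, mul_zero] using this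
  have h2 := (h1.pow d).mul_const
    (volume.real (Metric.closedBall (0 : EuclideanSpace ℝ (Fin d)) 1))
  rw [zero_pow hd, zero_mul] at h2
  refine h2.congr fun N => ?_
  rw [Measure.addHaar_real_closedBall' _ _ (r := 2 * ((3 : ℝ) ^ N)⁻¹) (by positivity), finrank_euclideanSpace_fin]

theorem tendsto_zero_of_norm_rpow_le {E : Type*} [SeminormedAddCommGroup E] {u : ℕ → E}
    {b : ℕ → ℝ} {q : ℝ} (hq : 0 < q) (h : ∀ᶠ n in atTop, ‖u n‖ ^ q ≤ b n)
    (hb : Tendsto b atTop (𝓝 0)) : Tendsto u atTop (𝓝 0) := by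
  rw [tendsto_zero_iff_norm_tendsto_zero]
  have h1 : Tendsto (fun n => ‖u n‖ ^ q) atTop (𝓝 0) :=
    squeeze_zero' (Eventually.of_forall fun n => by positivity) h hb
  have h2 := h1.rpow_const (p := q⁻¹) (Or.inr (by positivity))
  rw [Real.zero_rpow (by positivity)] at h2
  exact h2.congr fun n => Real.rpow_rpow_inv (norm_nonneg _) hq.ne'

theorem integral_multiscaleCutoff_rpow_le {q : ℝ} (hq : 0 < q) (N : ℕ) :
    Integrable (fun x => multiscaleCutoff d N x ^ q) ∧
    ∫ x, multiscaleCutoff d N x ^ q ≤ volume.real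
      (Metric.closedBall (0 : EuclideanSpace ℝ (Fin d)) (2 * ((3 : ℝ) ^ N)⁻¹)) := by
  set B := Metric.closedBall (0 : EuclideanSpace ℝ (Fin d)) (2 * ((3 : ℝ) ^ N)⁻¹)
  have hB : MeasurableSet B := Metric.isClosed_closedBall.measurableSet
  have hint : Integrable (B.indicator fun _ => (1 : ℝ)) :=
    (integrable_indicator_iff hB).2 (integrableOn_const measure_closedBall_lt_top.ne)
  have hle : ∀ x, multiscaleCutoff d N x ^ q ≤ B.indicator (fun _ => (1 : ℝ)) x := by
    intro x
    by_cases hx : x ∈ B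
    · rw [Set.indicator_of_mem hx]
      exact Real.rpow_le_one (multiscaleCutoff_nonneg N x) (multiscaleCutoff_le_one N x) hq.le
    · rw [Set.indicator_of_notMem hx, Function.notMem_support.1
        fun h => hx (support_multiscaleCutoff_subset N h), Real.zero_rpow hq.ne']
  have hnn : ∀ x, 0 ≤ multiscaleCutoff d N x ^ q := fun x =>
    Real.rpow_nonneg (multiscaleCutoff_nonneg N x) q
  constructor
  · refine hint.mono' (((contDiff_multiscaleCutoff N).continuous.rpow_const
      fun _ => Or.inr hq.le).aestronglyMeasurable) (ae_of_all _ fun x => ?_)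
    rw [Real.norm_of_nonneg (hnn x)]
    exact hle x
  · refine (integral_mono_of_nonneg (ae_of_all _ hnn) hint (ae_of_all _ hle)).trans_eq ?_
    rw [integral_indicator_const _ hB, smul_eq_mul, mul_one]

theorem tendsto_testToPair_cutoffTest (hpd : p ≤ d) (φ : 𝓓(Ω, ℝ)) (c : ℝ) {n₀ : ℕ} (hn₀ : 0 < n₀)
    (hN : ∀ n : ℕ, Metric.closedBall (0 : EuclideanSpace ℝ (Fin d))
      (2 * ((3 : ℝ) ^ (n + n₀))⁻¹) ⊆ Ω) :
    Tendsto (fun n => testToPair Ω p (cutoffTest φ c (hN n))) atTop (𝓝 0) := by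
  have hp1 : 1 < p := hp.out
  have hp0 : 0 < p := one_pos.trans hp1
  have hd : d ≠ 0 := by
    rintro rfl
    norm_num at hpd
    linarith
  obtain ⟨K₀, hK₀, hφ, hφ'⟩ := φ.exists_bound
  set K := |c| + K₀
  have hK : 0 ≤ K := by positivity
  have hcφ : ∀ x, |c - φ x| ≤ K := fun x => (abs_sub _ _).trans (add_le_add le_rfl (hφ x))
  have hφK : ∀ x, ‖fderiv ℝ φ x‖ ≤ K := fun x =>
    (hφ' x).trans (le_add_of_nonneg_left (abs_nonneg _))
  obtain ⟨C, hC⟩ := exists_integral_norm_fderiv_multiscaleCutoff_le (d := d) hp1 hpd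
  set v : ℕ → ℝ := fun N => volume.real
      (Metric.closedBall (0 : EuclideanSpace ℝ (Fin d)) (2 * ((3 : ℝ) ^ N)⁻¹))
  have hv : Tendsto (fun n => v (n + n₀)) atTop (𝓝 0) :=
    (tendsto_volume_closedBall_shrink hd).comp (tendsto_add_atTop_nat n₀)
  refine Prod.tendsto_iff _ _ |>.2 ⟨?_, ?_⟩
  · refine tendsto_zero_of_norm_rpow_le (b := fun n => K ^ p * v (n + n₀)) hp0
      (Eventually.of_forall fun n => ?_) (by simpa using hv.const_mul (K ^ p))
    obtain ⟨hi, hle⟩ := integral_multiscaleCutoff_rpow_le (d := d) hp0 (n + n₀)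
    rw [norm_rpow_Lp_eq_integral hp0]
    calc _ ≤ ∫ x in (Ω : Set (EuclideanSpace ℝ (Fin d))),
          K ^ p * multiscaleCutoff d (n + n₀) x ^ p := by
          refine integral_mono_of_nonneg (ae_of_all _ fun x => by positivity)
            (hi.const_mul _).restrict ?_
          filter_upwards [((cutoffTest φ c (hN n)).memLp_self p).coeFn_toLp] with x hx
          have hx' : (testToPair Ω p (cutoffTest φ c (hN n))).1 x =
            (c - φ x) * multiscaleCutoff d (n + n₀) x := hx
          rw [hx', norm_mul, Real.norm_of_nonneg (multiscaleCutoff_nonneg _ x),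
            ← Real.mul_rpow hK (multiscaleCutoff_nonneg _ x)]
          have := multiscaleCutoff_nonneg (d := d) (n + n₀) x
          exact Real.rpow_le_rpow (by positivity)
            (mul_le_mul_of_nonneg_right (hcφ x) this) hp0.le
      _ ≤ ∫ x, K ^ p * multiscaleCutoff d (n + n₀) x ^ p :=
          setIntegral_le_integral (hi.const_mul _) (ae_of_all _ fun x =>
            mul_nonneg (by positivity) (Real.rpow_nonneg (multiscaleCutoff_nonneg _ x) _))
      _ ≤ K ^ p * v (n + n₀) := by
          rw [integral_const_mul]
          gcongr
  · have ht : Tendsto (fun n : ℕ => ((n + n₀ : ℕ) : ℝ) ^ (1 - p)) atTop (𝓝 0) := by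
      have h1 := tendsto_rpow_neg_atTop (y := p - 1) (by linarith)
      rw [neg_sub] at h1
      exact h1.comp (tendsto_natCast_atTop_atTop.comp (tendsto_add_atTop_nat n₀))
    refine tendsto_zero_of_norm_rpow_le
      (b := fun n => K ^ p * 2 ^ (p - 1) * (C * ((n + n₀ : ℕ) : ℝ) ^ (1 - p) + v (n + n₀))) hp0
      (Eventually.of_forall fun n => ?_)
      (by simpa using ((ht.const_mul C).add hv).const_mul (K ^ p * 2 ^ (p - 1)))
    obtain ⟨hi, hle⟩ := integral_multiscaleCutoff_rpow_le (d := d) hp0 (n + n₀)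
    obtain ⟨hi', hle'⟩ := hC (n + n₀) (by lia)
    have hI := (hi'.add hi).const_mul (K ^ p * 2 ^ (p - 1))
    rw [norm_rpow_Lp_eq_integral hp0]
    calc _ ≤ ∫ x in (Ω : Set (EuclideanSpace ℝ (Fin d))), K ^ p * 2 ^ (p - 1) *
          (‖fderiv ℝ (multiscaleCutoff d (n + n₀)) x‖ ^ p +
            multiscaleCutoff d (n + n₀) x ^ p) := by
          refine integral_mono_of_nonneg (ae_of_all _ fun x => by positivity) hI.restrict ?_
          filter_upwards [((cutoffTest φ c (hN n)).memLp_gradient p).coeFn_toLp] with x hx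
          have hx' : (testToPair Ω p (cutoffTest φ c (hN n))).2 x =
            ∇ (cutoffTest φ c (hN n)) x := hx
          have hη := multiscaleCutoff_nonneg (d := d) (n + n₀) x
          rw [hx', norm_gradient_eq_norm_fderiv, mul_assoc]
          calc _ ≤ (K * (‖fderiv ℝ (multiscaleCutoff d (n + n₀)) x‖ +
                multiscaleCutoff d (n + n₀) x)) ^ p := by
                gcongr
                exact norm_fderiv_cutoffTest_le (hN n) hcφ hφK x
            _ ≤ _ := by
                rw [Real.mul_rpow hK (by positivity)]
                gcongr
                exact_mod_cast NNReal.rpow_add_le_mul_rpow_add_rpow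
                  ⟨_, norm_nonneg (fderiv ℝ (multiscaleCutoff d (n + n₀)) x)⟩ ⟨_, hη⟩ hp1.le
      _ ≤ ∫ x, K ^ p * 2 ^ (p - 1) *
          (‖fderiv ℝ (multiscaleCutoff d (n + n₀)) x‖ ^ p +
            multiscaleCutoff d (n + n₀) x ^ p) :=
          setIntegral_le_integral hI (ae_of_all _ fun x => mul_nonneg (by positivity)
            (add_nonneg (by positivity) (Real.rpow_nonneg (multiscaleCutoff_nonneg _ x) _)))
      _ ≤ _ := by
          rw [integral_const_mul, integral_add hi' hi]
          gcongr

/-- Points have zero `p`-capacity for `p ≤ d`: a test function can be replaced, at arbitrarily small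
cost in `W^{1,p}`, by one equal to a prescribed constant near `0`. -/
theorem exists_tendsto_testToW0_eq_const (hΩ0 : (0 : EuclideanSpace ℝ (Fin d)) ∈ Ω)
    (hpd : p ≤ d) (φ : 𝓓(Ω, ℝ)) (c : ℝ) :
    ∃ (ψ : ℕ → 𝓓(Ω, ℝ)) (ρ : ℕ → ℝ), (∀ n, 0 < ρ n) ∧ (∀ n x, ‖x‖ < ρ n → ψ n x = c) ∧
      Tendsto (fun n => testToW0 Ω p (ψ n)) atTop (𝓝 (testToW0 Ω p φ)) := by
  obtain ⟨r, hr, hrΩ⟩ := Metric.isOpen_iff.1 Ω.isOpen 0 hΩ0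
  have h1 : Tendsto (fun N : ℕ => (2 * ((3 : ℝ) ^ N)⁻¹)) atTop (𝓝 0) := by
    have := (tendsto_pow_atTop_nhds_zero_of_lt_one (r := (3 : ℝ)⁻¹) (by positivity)
      (by norm_num)).const_mul 2
    simpa only [inv_pow, mul_zero] using this
  obtain ⟨n₀, hn₀⟩ := eventually_atTop.1 ((h1.eventually (gt_mem_nhds hr)).and
    (eventually_gt_atTop 0))
  have hN : ∀ n : ℕ, Metric.closedBall (0 : EuclideanSpace ℝ (Fin d))
      (2 * ((3 : ℝ) ^ (n + n₀))⁻¹) ⊆ Ω := fun n =>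
    (Metric.closedBall_subset_ball (hn₀ (n + n₀) (by lia)).1).trans hrΩ
  refine ⟨fun n => φ + cutoffTest φ c (hN n), fun n => ((3 : ℝ) ^ (2 * (n + n₀)))⁻¹,
    fun n => by positivity, fun n x hx => ?_, ?_⟩
  · have h2 : (φ + cutoffTest φ c (hN n)) x =
      φ x + (c - φ x) * multiscaleCutoff d (n + n₀) x := rfl
    rw [h2, multiscaleCutoff_eq_one (hn₀ (n + n₀) (by lia)).2 hx.le]
    ring
  · rw [tendsto_subtype_rng]
    have := (tendsto_testToPair_cutoffTest (p := p) hpd φ c (hn₀ n₀ le_rfl).2 hN).const_add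
      (testToPair Ω p φ)
    rw [add_zero] at this
    exact this.congr fun n => (map_add _ _ _).symm

variable [IsFiniteMeasure (volume.restrict (Ω : Set (EuclideanSpace ℝ (Fin d))))]

theorem le_integral_add_of_isWeakGammaLimit (hΩ0 : (0 : EuclideanSpace ℝ (Fin d)) ∈ Ω)
    (hpd : p ≤ d) {ε : ℕ → ℝ} (hεpos : ∀ k, 0 < ε k) (hεlim : Tendsto ε atTop (𝓝 0))
    {F : W0 Ω p → EReal}
    (hF : IsWeakGammaLimit (fun k (u : W0 Ω p) => ((ballEnergy (ε k) u : ℝ) : EReal)) F)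
    (φ : 𝓓(Ω, ℝ)) (c : ℝ) :
    F (testToW0 Ω p φ) ≤
      (((∫ x in (Ω : Set (EuclideanSpace ℝ (Fin d))), |φ x - c| ^ p) +
        ∫ x in (Ω : Set (EuclideanSpace ℝ (Fin d))), ‖∇ φ x‖ ^ p : ℝ) : EReal) := by
  have hp0 : 0 < p := one_pos.trans hp.out
  set μ := volume.restrict (Ω : Set (EuclideanSpace ℝ (Fin d)))
  -- along a diagonal sequence, the ball of radius `ε k` lies where the approximant equals `c`
  obtain ⟨ψ, ρ, hρ, hψ, hlim⟩ := exists_tendsto_testToW0_eq_const (p := p) hΩ0 hpd φ c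
  obtain ⟨j, hj, hjρ⟩ := exists_tendsto_atTop_eventually (P := fun j k => ε k < ρ j)
    fun j => hεlim.eventually (gt_mem_nhds (hρ j))
  have hlim' := hlim.comp hj
  refine (hF.1 _ _ hlim'.weaklyTendsto).trans (le_of_eq (Tendsto.liminf_eq ?_))
  refine (continuous_coe_real_ereal.tendsto _).comp ?_
  have e : ∀ u : W0 Ω p, ‖w0Val u - Lp.const (ENNReal.ofReal p) μ c‖ ^ p =
      ∫ x, |w0Val u x - c| ^ p ∂μ := by
    intro u
    rw [norm_rpow_Lp_eq_integral hp0]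
    refine integral_congr_ae ?_
    filter_upwards [Lp.coeFn_sub (w0Val u) (Lp.const (ENNReal.ofReal p) μ c),
      Lp.coeFn_const (ENNReal.ofReal p) μ c] with x h1 h2
    rw [h1, Pi.sub_apply, h2, Function.const_apply, Real.norm_eq_abs]
  have hcont : Continuous fun u : W0 Ω p =>
      ‖w0Val u - Lp.const (ENNReal.ofReal p) μ c‖ ^ p + ‖w0Grad u‖ ^ p :=
    (((w0ValL Ω p).continuous.sub continuous_const).norm.rpow_const fun _ => Or.inr hp0.le).add
      ((w0GradL Ω p).continuous.norm.rpow_const fun _ => Or.inr hp0.le)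
  have hlim2 := (hcont.tendsto _).comp hlim'
  have e2 : ‖w0Val (testToW0 Ω p φ) - Lp.const (ENNReal.ofReal p) μ c‖ ^ p +
      ‖w0Grad (testToW0 Ω p φ)‖ ^ p =
      (∫ x, |φ x - c| ^ p ∂μ) + ∫ x, ‖∇ φ x‖ ^ p ∂μ := by
    rw [e, norm_rpow_Lp_eq_integral hp0, integral_norm_w0Grad_testToW0]
    congr 1
    refine integral_congr_ae ?_
    filter_upwards [w0Val_testToW0 (p := p) φ] with x hx
    rw [hx]
  rw [e2] at hlim2
  refine hlim2.congr' ?_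
  filter_upwards [hjρ, hεlim.eventually (eventually_ball_subset (Ω.isOpen.mem_nhds hΩ0))]
    with k hk hkΩ
  rw [Function.comp_apply, Function.comp_apply,
    ballEnergy_testToW0_of_eq_const (hεpos k) hk.le hkΩ (hψ (j k)), e,
    norm_rpow_Lp_eq_integral hp0]

/-- The Γ-limit is the infimum over `c` of `∫ |φ - c|^p + ∫ |∇φ|^p`: in the limit, the value `c`
taken near the origin is independent of `φ` and adjusts itself optimally. -/
theorem gammaLimit_testToW0_eq (hΩ0 : (0 : EuclideanSpace ℝ (Fin d)) ∈ Ω)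
    (hpd : p ≤ d) {ε : ℕ → ℝ} (hεpos : ∀ k, 0 < ε k) (hεlim : Tendsto ε atTop (𝓝 0))
    {F : W0 Ω p → EReal}
    (hF : IsWeakGammaLimit (fun k (u : W0 Ω p) => ((ballEnergy (ε k) u : ℝ) : EReal)) F)
    (φ : 𝓓(Ω, ℝ)) :
    F (testToW0 Ω p φ) =
      ((lpOsc (volume.restrict (Ω : Set (EuclideanSpace ℝ (Fin d)))) p φ +
        ∫ x in (Ω : Set (EuclideanSpace ℝ (Fin d))), ‖∇ φ x‖ ^ p : ℝ) : EReal) := by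
  refine le_antisymm ?_ ?_
  · refine EReal.le_of_forall_lt_iff_le.1 fun z hz => ?_
    rw [EReal.coe_lt_coe_iff] at hz
    obtain ⟨c, hc⟩ := exists_lt_of_ciInf_lt (lt_sub_iff_add_lt.2 hz)
    refine (le_integral_add_of_isWeakGammaLimit hΩ0 hpd hεpos hεlim hF φ c).trans ?_
    exact EReal.coe_le_coe_iff.2 (lt_sub_iff_add_lt.1 hc).le
  · have := lpOsc_add_le_of_isWeakGammaLimit hΩ0 hεpos hεlim hF (testToW0 Ω p φ)
    rwa [integral_norm_w0Grad_testToW0, lpOsc_congr (w0Val_testToW0 φ)] at this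

end UpperBound

/-! ### From test functions to two-valued functions -/

section TwoValued

variable {d : ℕ} {Ω : Opens (EuclideanSpace ℝ (Fin d))}

open Classical in
/-- The function equal to `s` on `A` and to `t` off `A`. -/
def twoValued {α : Type*} (A : Set α) (s t : ℝ) (x : α) : ℝ := if x ∈ A then s else t

theorem twoValued_of_mem {α : Type*} {A : Set α} {x : α} (hx : x ∈ A) (s t : ℝ) :
    twoValued A s t x = s := if_pos hx

theorem twoValued_of_notMem {α : Type*} {A : Set α} {x : α} (hx : x ∉ A) (s t : ℝ) :
    twoValued A s t x = t := if_neg hx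

theorem measurable_twoValued {α : Type*} [MeasurableSpace α] {A : Set α} (hA : MeasurableSet A)
    (s t : ℝ) : Measurable (twoValued A s t) := by
  classical
  exact Measurable.ite hA measurable_const measurable_const

theorem abs_twoValued_le {α : Type*} (A : Set α) (s t : ℝ) (x : α) :
    |twoValued A s t x| ≤ |s| + |t| := by
  unfold twoValued
  split_ifs
  · exact le_add_of_nonneg_right (abs_nonneg t)
  · exact le_add_of_nonneg_left (abs_nonneg s)

theorem IsCompact.exists_testFunction_eq_one {K : Set (EuclideanSpace ℝ (Fin d))}
    {U : Set (EuclideanSpace ℝ (Fin d))} (hK : IsCompact K) (hU : IsOpen U) (hKU : K ⊆ U)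
    (hUΩ : U ⊆ Ω) :
    ∃ χ : 𝓓(Ω, ℝ), (∀ x ∈ K, χ x = 1) ∧ (∀ x ∉ U, χ x = 0) ∧ ∀ x, χ x ∈ Set.Icc (0 : ℝ) 1 := by
  obtain ⟨L, hL, hKL, hLU⟩ := exists_compact_between hK hU hKU
  obtain ⟨χ, h1, h0, hχ⟩ := exists_contMDiffMap_one_nhds_of_subset_interior
    (n := ⊤) (modelWithCornersSelf ℝ (EuclideanSpace ℝ (Fin d))) hK.isClosed hKL
  have hsupp : Function.support χ ⊆ L := fun x hx => by
    by_contra h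
    exact hx (h0 x h)
  refine ⟨⟨χ, χ.contMDiff.contDiff, HasCompactSupport.of_support_subset_isCompact hL hsupp,
    (closure_minimal hsupp hL.isClosed).trans (hLU.trans hUΩ)⟩,
    fun x hx => h1.self_of_nhdsSet x hx, fun x hx => h0 x fun h => hx (hLU h), hχ⟩

theorem exists_testFunction_approx_twoValued {l : Measure (EuclideanSpace ℝ (Fin d))}
    [IsFiniteMeasure l] {A : Set (EuclideanSpace ℝ (Fin d))} (hA : MeasurableSet A) (s t : ℝ)
    {δ : ℝ≥0∞} (hδ : δ ≠ 0) :
    ∃ (φ : 𝓓(Ω, ℝ)) (S : Set (EuclideanSpace ℝ (Fin d))), l S ≤ δ + δ ∧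
      (∀ x, |φ x| ≤ |s| + |t|) ∧ ∀ x ∈ Ω, x ∉ S → φ x = twoValued A s t x := by
  have hΩ : MeasurableSet (Ω : Set (EuclideanSpace ℝ (Fin d))) := Ω.isOpen.measurableSet
  obtain ⟨K, hKA, hK, hKδ⟩ := (hΩ.inter hA).exists_isCompact_sdiff_lt (measure_ne_top l _) hδ
  obtain ⟨K', hKA', hK', hKδ'⟩ := (hΩ.diff hA).exists_isCompact_sdiff_lt (measure_ne_top l _) hδ
  have hdisj : ∀ x, x ∈ K → x ∉ K' := fun x hx hx' => (hKA' hx').2 (hKA hx).2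
  obtain ⟨χ, h1, h0, hχ⟩ := hK.exists_testFunction_eq_one (Ω := Ω)
    (Ω.isOpen.inter hK'.isClosed.isOpen_compl) (fun x hx => ⟨(hKA hx).1, hdisj x hx⟩)
    Set.inter_subset_left
  obtain ⟨χ', h1', h0', hχ'⟩ := hK'.exists_testFunction_eq_one (Ω := Ω)
    (Ω.isOpen.inter hK.isClosed.isOpen_compl)
    (fun x hx => ⟨(hKA' hx).1, fun h => hdisj x h hx⟩) Set.inter_subset_left
  have happ : ∀ x, (s • χ + t • χ') x = s * χ x + t * χ' x := fun x => rfl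
  refine ⟨s • χ + t • χ', ((Ω ∩ A) \ K) ∪ ((Ω \ A) \ K'),
    (measure_union_le _ _).trans (add_le_add hKδ.le hKδ'.le), fun x => ?_, fun x hx hS => ?_⟩
  · rw [happ]
    refine (abs_add_le _ _).trans (add_le_add ?_ ?_)
    · rw [abs_mul, abs_of_nonneg (hχ x).1]
      exact mul_le_of_le_one_right (abs_nonneg _) (hχ x).2
    · rw [abs_mul, abs_of_nonneg (hχ' x).1]
      exact mul_le_of_le_one_right (abs_nonneg _) (hχ' x).2
  · rw [happ]
    by_cases hxA : x ∈ A
    · have hxK : x ∈ K := by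
        by_contra h
        exact hS (Or.inl ⟨⟨hx, hxA⟩, h⟩)
      rw [twoValued_of_mem hxA, h1 x hxK, h0' x fun h => h.2 hxK, mul_one, mul_zero, add_zero]
    · have hxK : x ∈ K' := by
        by_contra h
        exact hS (Or.inr ⟨⟨hx, hxA⟩, h⟩)
      rw [twoValued_of_notMem hxA, h1' x hxK, h0 x fun h => h.2 hxK, mul_one, mul_zero, zero_add]

theorem exists_seq_testFunction_tendsto_twoValued {l : Measure (EuclideanSpace ℝ (Fin d))}
    [IsFiniteMeasure l] (hl : ∀ᵐ x ∂l, x ∈ Ω) {A : Set (EuclideanSpace ℝ (Fin d))}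
    (hA : MeasurableSet A) (s t : ℝ) :
    ∃ φ : ℕ → 𝓓(Ω, ℝ), (∀ n x, |φ n x| ≤ |s| + |t|) ∧
      ∀ᵐ x ∂l, Tendsto (fun n => φ n x) atTop (𝓝 (twoValued A s t x)) := by
  have h2 : ∀ n : ℕ, (2⁻¹ : ℝ≥0∞) ^ n ≠ 0 := fun n => by simp
  choose φ S hS hb heq using fun n : ℕ =>
    exists_testFunction_approx_twoValued (Ω := Ω) (l := l) hA s t (h2 n)
  refine ⟨φ, hb, ?_⟩
  have hsum : ∑' n, l (S n) ≠ ⊤ := by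
    refine ne_top_of_le_ne_top ?_ (ENNReal.tsum_le_tsum hS)
    rw [ENNReal.tsum_add, ENNReal.tsum_geometric]
    simp
  filter_upwards [ae_eventually_notMem hsum, hl] with x hx hxΩ
  refine tendsto_const_nhds.congr' ?_
  filter_upwards [hx] with n hn
  exact (heq n x hxΩ hn).symm

theorem exists_abs_le_of_continuous_prod {f : ℝ × ℝ → ℝ} (hf : Continuous f) (R : ℝ) :
    ∃ C : ℝ, ∀ a b : ℝ, |a| ≤ R → |b| ≤ R → |f (a, b)| ≤ C := by
  obtain ⟨C, hC⟩ := (isCompact_Icc.prod isCompact_Icc :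
    IsCompact (Set.Icc (-R) R ×ˢ Set.Icc (-R) R)).exists_bound_of_continuousOn hf.continuousOn
  exact ⟨C, fun a b ha hb => hC (a, b) ⟨abs_le.1 ha, abs_le.1 hb⟩⟩

variable {p : ℝ} [hp : Fact (1 < p)]

variable [IsFiniteMeasure (volume.restrict (Ω : Set (EuclideanSpace ℝ (Fin d))))]

/-- An integral identity for test functions extends, by bounded approximation, to functions that
take two values. -/
theorem integral_twoValued_eq_lpOsc {f : ℝ × ℝ → ℝ} {g : ℝ → ℝ} {μ : Measure (Ω × Ω)}
    {ν : Measure Ω} [IsFiniteMeasure μ] [IsFiniteMeasure ν] (hf : Continuous f) (hg : Continuous g)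
    (H : ∀ φ : 𝓓(Ω, ℝ), (∫ z : Ω × Ω, f (φ z.1, φ z.2) ∂μ) + (∫ x : Ω, g (φ x) ∂ν) =
      lpOsc (volume.restrict (Ω : Set (EuclideanSpace ℝ (Fin d)))) p φ)
    {A : Set (EuclideanSpace ℝ (Fin d))} (hA : MeasurableSet A) (s t : ℝ) :
    (∫ z : Ω × Ω, f (twoValued A s t z.1, twoValued A s t z.2) ∂μ) +
        (∫ x : Ω, g (twoValued A s t x) ∂ν) =
      lpOsc (volume.restrict (Ω : Set (EuclideanSpace ℝ (Fin d)))) p (twoValued A s t) := by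
  -- the approximation has to hold almost everywhere for every measure occurring in the identity
  set l : Measure (EuclideanSpace ℝ (Fin d)) :=
    volume.restrict (Ω : Set (EuclideanSpace ℝ (Fin d))) + ν.map Subtype.val +
      μ.map (fun z => (z.1 : EuclideanSpace ℝ (Fin d))) +
      μ.map (fun z => (z.2 : EuclideanSpace ℝ (Fin d)))
  have hm1 : Measurable fun z : Ω × Ω => (z.1 : EuclideanSpace ℝ (Fin d)) := by fun_prop
  have hm2 : Measurable fun z : Ω × Ω => (z.2 : EuclideanSpace ℝ (Fin d)) := by fun_prop
  have hm3 : Measurable fun z : Ω => (z : EuclideanSpace ℝ (Fin d)) := by fun_prop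
  have hΩ : MeasurableSet (Ω : Set (EuclideanSpace ℝ (Fin d))) := Ω.isOpen.measurableSet
  have hl : ∀ᵐ x ∂l, x ∈ Ω := by
    refine ae_add_measure_iff.2 ⟨ae_add_measure_iff.2 ⟨ae_add_measure_iff.2
      ⟨ae_restrict_mem hΩ, ?_⟩, ?_⟩, ?_⟩
    · exact (ae_map_iff hm3.aemeasurable hΩ).2 (ae_of_all _ fun x => x.2)
    · exact (ae_map_iff hm1.aemeasurable hΩ).2 (ae_of_all _ fun x => x.1.2)
    · exact (ae_map_iff hm2.aemeasurable hΩ).2 (ae_of_all _ fun x => x.2.2)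
  obtain ⟨φ, hb, hlim⟩ := exists_seq_testFunction_tendsto_twoValued hl hA s t
  obtain ⟨h123, h4⟩ := ae_add_measure_iff.1 hlim
  obtain ⟨h12, h3⟩ := ae_add_measure_iff.1 h123
  obtain ⟨h1, h2⟩ := ae_add_measure_iff.1 h12
  replace h2 := ae_of_ae_map hm3.aemeasurable h2
  replace h3 := ae_of_ae_map hm1.aemeasurable h3
  replace h4 := ae_of_ae_map hm2.aemeasurable h4
  have hA' := measurable_twoValued hA s t
  obtain ⟨C, hC⟩ := exists_abs_le_of_continuous_prod hf (|s| + |t|)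
  obtain ⟨C', hC'⟩ := exists_abs_le_of_continuous_prod (hg.comp continuous_fst) (|s| + |t|)
  have T1 : Tendsto (fun n => ∫ z : Ω × Ω, f (φ n z.1, φ n z.2) ∂μ) atTop
      (𝓝 (∫ z : Ω × Ω, f (twoValued A s t z.1, twoValued A s t z.2) ∂μ)) := by
    refine tendsto_integral_of_dominated_convergence (fun _ => C) (fun n => ?_)
      (integrable_const C) (fun n => ae_of_all _ fun z => hC _ _ (hb n _) (hb n _)) ?_
    · have h := (φ n).continuous.measurable
      exact (hf.measurable.comp ((h.comp hm1).prodMk (h.comp hm2))).aestronglyMeasurable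
    · filter_upwards [h3, h4] with z h3 h4
      exact (hf.tendsto _).comp (h3.prodMk_nhds h4)
  have T2 : Tendsto (fun n => ∫ x : Ω, g (φ n x) ∂ν) atTop
      (𝓝 (∫ x : Ω, g (twoValued A s t x) ∂ν)) := by
    refine tendsto_integral_of_dominated_convergence (fun _ => C') (fun n => ?_)
      (integrable_const C') (fun n => ae_of_all _ fun z => hC' _ 0 (hb n _)
        (by rw [abs_zero]; positivity)) ?_
    · have h := (φ n).continuous.measurable
      exact (hg.measurable.comp (h.comp hm3)).aestronglyMeasurable
    · filter_upwards [h2] with z h2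
      exact (hg.tendsto _).comp h2
  have T3 : Tendsto (fun n => lpOsc (volume.restrict (Ω : Set (EuclideanSpace ℝ (Fin d)))) p (φ n))
      atTop (𝓝 (lpOsc (volume.restrict (Ω : Set (EuclideanSpace ℝ (Fin d)))) p
        (twoValued A s t))) :=
    tendsto_lpOsc_of_bounded_ae (R := |s| + |t|)
      (fun n => (φ n).continuous.aestronglyMeasurable) hA'.aestronglyMeasurable
      (fun n => ae_of_all _ (hb n)) (ae_of_all _ (abs_twoValued_le A s t)) h1
  refine tendsto_nhds_unique (T1.add T2) (T3.congr fun n => (H (φ n)).symm)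

end TwoValued

/-! ### Distance to the constants of two-valued functions -/

section TwoValuedOsc

theorem add_mul_le_abs_rpow {p x₀ : ℝ} (hp : 1 < p) (hx₀ : 0 < x₀) (x : ℝ) :
    x₀ ^ p + p * x₀ ^ (p - 1) * (x - x₀) ≤ |x| ^ p := by
  have hb : 1 + p * (|x| / x₀ - 1) ≤ (1 + (|x| / x₀ - 1)) ^ p :=
    one_add_mul_self_le_rpow_one_add (by linarith [div_nonneg (abs_nonneg x) hx₀.le]) hp.le
  have hx : x₀ ^ p = x₀ ^ (p - 1) * x₀ := by
    rw [← Real.rpow_add_one hx₀.ne', sub_add_cancel]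
  calc x₀ ^ p + p * x₀ ^ (p - 1) * (x - x₀) ≤ x₀ ^ p + p * x₀ ^ (p - 1) * (|x| - x₀) := by
        gcongr
        exact le_abs_self x
    _ = x₀ ^ p * (1 + p * (|x| / x₀ - 1)) := by
        rw [hx]
        field_simp
    _ ≤ x₀ ^ p * (1 + (|x| / x₀ - 1)) ^ p := by gcongr
    _ = |x| ^ p := by
        rw [add_sub_cancel, Real.div_rpow (abs_nonneg x) hx₀.le,
          mul_div_cancel₀ _ (by positivity)]

variable {α : Type*} {m : MeasurableSpace α} {κ : Measure α}

theorem integral_twoValued [IsFiniteMeasure κ] {A : Set α} (hA : MeasurableSet A) (s t : ℝ) (h : ℝ → ℝ) :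
    ∫ x, h (twoValued A s t x) ∂κ = κ.real A * h s + κ.real Aᶜ * h t := by
  have e : ∀ x, h (twoValued A s t x) =
      A.indicator (fun _ => h s) x + Aᶜ.indicator (fun _ => h t) x := by
    intro x
    by_cases hx : x ∈ A <;> simp [twoValued, hx]
  simp only [e]
  rw [integral_add ((integrable_const _).indicator hA) ((integrable_const _).indicator hA.compl),
    integral_indicator_const _ hA, integral_indicator_const _ hA.compl, smul_eq_mul, smul_eq_mul]

theorem lpOsc_twoValued_empty {p : ℝ} (hp : 0 < p) (s t : ℝ) :
    lpOsc κ p (twoValued ∅ s t) = 0 := by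
  have h : ∫ x, |twoValued (∅ : Set α) s t x - t| ^ p ∂κ = 0 := by
    simp [twoValued, Real.zero_rpow hp.ne']
  rw [lpOsc_eq_of_forall_le (c₀ := t), h]
  intro c
  rw [h]
  exact integral_nonneg fun x => by positivity

/-- If `x₀ + y₀ = 1` and `κ(A) x₀^(p-1) = κ(Aᶜ) y₀^(p-1)`, then `y₀` is the constant closest in
`L^p` to the indicator of `A`, as the linear terms of the tangent line inequality cancel. -/
theorem lpOsc_twoValued_one_zero [IsFiniteMeasure κ] {p : ℝ} (hp : 1 < p) {A : Set α} (hA : MeasurableSet A)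
    {x₀ y₀ : ℝ} (hx₀ : 0 < x₀) (hy₀ : 0 < y₀) (hxy : x₀ + y₀ = 1)
    (h : κ.real A * x₀ ^ (p - 1) = κ.real Aᶜ * y₀ ^ (p - 1)) :
    lpOsc κ p (twoValued A 1 0) = κ.real Aᶜ * y₀ ^ (p - 1) := by
  have hI : ∀ c : ℝ, ∫ x, |twoValued A 1 0 x - c| ^ p ∂κ =
      κ.real A * |1 - c| ^ p + κ.real Aᶜ * |c| ^ p := by
    intro c
    rw [integral_twoValued hA 1 0 fun v => |v - c| ^ p, zero_sub, abs_neg]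
  have hval : κ.real A * x₀ ^ p + κ.real Aᶜ * y₀ ^ p = κ.real Aᶜ * y₀ ^ (p - 1) := by
    have e1 : x₀ ^ p = x₀ ^ (p - 1) * x₀ := by
      rw [← Real.rpow_add_one hx₀.ne', sub_add_cancel]
    have e2 : y₀ ^ p = y₀ ^ (p - 1) * y₀ := by
      rw [← Real.rpow_add_one hy₀.ne', sub_add_cancel]
    rw [e1, e2, ← mul_assoc, ← mul_assoc, h, ← mul_add, hxy, mul_one]
  have h0 : ∫ x, |twoValued A 1 0 x - y₀| ^ p ∂κ = κ.real Aᶜ * y₀ ^ (p - 1) := by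
    rw [hI, ← hval, show 1 - y₀ = x₀ by linarith, abs_of_pos hx₀, abs_of_pos hy₀]
  rw [lpOsc_eq_of_forall_le (c₀ := y₀), h0]
  intro c
  rw [h0, hI, ← hval]
  have i1 := mul_le_mul_of_nonneg_left (add_mul_le_abs_rpow hp hx₀ (1 - c))
    (measureReal_nonneg (μ := κ) (s := A))
  have i2 := mul_le_mul_of_nonneg_left (add_mul_le_abs_rpow hp hy₀ c)
    (measureReal_nonneg (μ := κ) (s := Aᶜ))
  have i3 : κ.real A * (p * x₀ ^ (p - 1) * (1 - c - x₀)) +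
      κ.real Aᶜ * (p * y₀ ^ (p - 1) * (c - y₀)) = 0 := by
    have : 1 - c - x₀ = -(c - y₀) := by linarith
    rw [this]
    linear_combination (-(p * (c - y₀))) * h
  linarith

theorem lpOsc_two_twoValued [IsFiniteMeasure κ] {A : Set α} (hA : MeasurableSet A) (s t : ℝ)
    (hκ : 0 < κ.real Set.univ) :
    lpOsc κ 2 (twoValued A s t) = |s - t| ^ 2 * (κ.real A * κ.real Aᶜ / κ.real Set.univ) := by
  have hI : ∀ c : ℝ, ∫ x, |twoValued A s t x - c| ^ (2 : ℝ) ∂κ =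
      κ.real A * (s - c) ^ 2 + κ.real Aᶜ * (t - c) ^ 2 := by
    intro c
    rw [integral_twoValued hA s t fun v => |v - c| ^ (2 : ℝ)]
    simp only [Real.rpow_two, sq_abs]
  have hsum : κ.real A + κ.real Aᶜ = κ.real Set.univ := measureReal_add_measureReal_compl hA
  rw [← hsum] at hκ ⊢
  set a := κ.real A
  set b := κ.real Aᶜ
  have hmin : ∀ c : ℝ, a * (s - c) ^ 2 + b * (t - c) ^ 2 =
      |s - t| ^ 2 * (a * b / (a + b)) + (a + b) * (c - (a * s + b * t) / (a + b)) ^ 2 := by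
    intro c
    rw [sq_abs]
    field_simp
    ring
  rw [lpOsc_eq_of_forall_le (c₀ := (a * s + b * t) / (a + b)), hI, hmin, sub_self]
  · ring
  · intro c
    rw [hI, hI, hmin, hmin c, sub_self]
    have : 0 ≤ (a + b) * (c - (a * s + b * t) / (a + b)) ^ 2 := by positivity
    linarith

end TwoValuedOsc

/-! ### Second differences -/

section SecondDifference

variable {α : Type*} {m : MeasurableSpace α}

theorem twoValued_union_sub {A B : Set α} (hAB : Disjoint A B) (s t : ℝ) (h : ℝ → ℝ) (x : α) :
    h (twoValued (A ∪ B) s t x) = h (twoValued A s t x) + h (twoValued B s t x) -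
      h (twoValued ∅ s t x) := by
  by_cases hA : x ∈ A
  · have hB : x ∉ B := Set.disjoint_left.1 hAB hA
    simp [twoValued, hA, hB]
  · by_cases hB : x ∈ B <;> simp [twoValued, hA, hB]

theorem twoValued_prod_union_sub {A B : Set α} (hAB : Disjoint A B) (s t : ℝ) (f : ℝ × ℝ → ℝ)
    (z : α × α) :
    f (twoValued (A ∪ B) s t z.1, twoValued (A ∪ B) s t z.2) =
      f (twoValued A s t z.1, twoValued A s t z.2) + f (twoValued B s t z.1, twoValued B s t z.2) -
        f (twoValued ∅ s t z.1, twoValued ∅ s t z.2) -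
        ((A ×ˢ B).indicator (fun _ => f (s, t) + f (t, s) - f (s, s) - f (t, t)) z +
          (B ×ˢ A).indicator (fun _ => f (s, t) + f (t, s) - f (s, s) - f (t, t)) z) := by
  have hd : ∀ x, x ∈ A → x ∉ B := fun x hx => Set.disjoint_left.1 hAB hx
  obtain ⟨x, y⟩ := z
  by_cases hxA : x ∈ A <;> by_cases hyA : y ∈ A
  · simp [twoValued, hxA, hyA, hd x hxA, hd y hyA]
  · by_cases hyB : y ∈ B
    · simp [twoValued, hxA, hyA, hd x hxA, hyB]
    · simp [twoValued, hxA, hyA, hd x hxA, hyB]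
  · by_cases hxB : x ∈ B
    · simp [twoValued, hxA, hyA, hd y hyA, hxB]
      ring
    · simp [twoValued, hxA, hyA, hd y hyA, hxB]
  · by_cases hxB : x ∈ B <;> by_cases hyB : y ∈ B <;> simp [twoValued, hxA, hyA, hxB, hyB]

theorem integrable_comp_twoValued {κ : Measure α} [IsFiniteMeasure κ] {A : Set α}
    (hA : MeasurableSet A) (s t : ℝ) {g : ℝ → ℝ} (hg : Continuous g) :
    Integrable (fun x => g (twoValued A s t x)) κ := by
  obtain ⟨C, hC⟩ := exists_abs_le_of_continuous_prod (hg.comp continuous_fst) (|s| + |t|)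
  exact Integrable.of_bound (hg.measurable.comp (measurable_twoValued hA s t)).aestronglyMeasurable
    C (ae_of_all _ fun x => hC _ 0 (abs_twoValued_le A s t x) (by rw [abs_zero]; positivity))

theorem integrable_comp_twoValued_prod {μ : Measure (α × α)} [IsFiniteMeasure μ] {A : Set α}
    (hA : MeasurableSet A) (s t : ℝ) {f : ℝ × ℝ → ℝ} (hf : Continuous f) :
    Integrable (fun z : α × α => f (twoValued A s t z.1, twoValued A s t z.2)) μ := by
  obtain ⟨C, hC⟩ := exists_abs_le_of_continuous_prod hf (|s| + |t|)
  have h := measurable_twoValued hA s t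
  exact Integrable.of_bound (hf.measurable.comp
    ((h.comp measurable_fst).prodMk (h.comp measurable_snd))).aestronglyMeasurable
    C (ae_of_all _ fun z => hC _ _ (abs_twoValued_le A s t _) (abs_twoValued_le A s t _))

variable {d : ℕ} {Ω : Opens (EuclideanSpace ℝ (Fin d))} {p : ℝ} [hp : Fact (1 < p)]
  [IsFiniteMeasure (volume.restrict (Ω : Set (EuclideanSpace ℝ (Fin d))))]

/-- The second difference of the set function `A ↦ lpOsc (s on A, t off A)` sees only the
interaction through `μ` of the two sets; the local term involving `ν` drops out. -/
theorem lpOsc_twoValued_union {f : ℝ × ℝ → ℝ} {g : ℝ → ℝ} {μ : Measure (Ω × Ω)}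
    {ν : Measure Ω} [IsFiniteMeasure μ] [IsFiniteMeasure ν] (hf : Continuous f) (hg : Continuous g)
    (H : ∀ φ : 𝓓(Ω, ℝ), (∫ z : Ω × Ω, f (φ z.1, φ z.2) ∂μ) + (∫ x : Ω, g (φ x) ∂ν) =
      lpOsc (volume.restrict (Ω : Set (EuclideanSpace ℝ (Fin d)))) p φ)
    {A B : Set (EuclideanSpace ℝ (Fin d))} (hA : MeasurableSet A) (hB : MeasurableSet B)
    (hAB : Disjoint A B) (s t : ℝ) :
    lpOsc (volume.restrict (Ω : Set (EuclideanSpace ℝ (Fin d)))) p (twoValued (A ∪ B) s t) =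
      lpOsc (volume.restrict (Ω : Set (EuclideanSpace ℝ (Fin d)))) p (twoValued A s t) +
      lpOsc (volume.restrict (Ω : Set (EuclideanSpace ℝ (Fin d)))) p (twoValued B s t) -
      (f (s, t) + f (t, s) - f (s, s) - f (t, t)) *
        (μ.real ((Subtype.val ⁻¹' A) ×ˢ (Subtype.val ⁻¹' B)) +
          μ.real ((Subtype.val ⁻¹' B) ×ˢ (Subtype.val ⁻¹' A))) := by
  have hp0 : 0 < p := one_pos.trans hp.out
  have hA' : MeasurableSet (Subtype.val ⁻¹' A : Set Ω) := measurable_subtype_coe hA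
  have hB' : MeasurableSet (Subtype.val ⁻¹' B : Set Ω) := measurable_subtype_coe hB
  have hAB' : Disjoint (Subtype.val ⁻¹' A : Set Ω) (Subtype.val ⁻¹' B) := hAB.preimage _
  have pull : ∀ (S : Set (EuclideanSpace ℝ (Fin d))) (x : Ω),
      twoValued S s t x = twoValued (Subtype.val ⁻¹' S : Set Ω) s t x := fun _ _ => rfl
  have HA := integral_twoValued_eq_lpOsc hf hg H hA s t
  have HB := integral_twoValued_eq_lpOsc hf hg H hB s t
  have HAB := integral_twoValued_eq_lpOsc hf hg H (hA.union hB) s t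
  have H0 := integral_twoValued_eq_lpOsc hf hg H MeasurableSet.empty s t
  rw [lpOsc_twoValued_empty hp0] at H0
  simp only [pull, Set.preimage_union, Set.preimage_empty] at HA HB HAB H0
  set A' : Set Ω := Subtype.val ⁻¹' A
  set B' : Set Ω := Subtype.val ⁻¹' B
  simp only [twoValued_union_sub hAB' s t g, twoValued_prod_union_sub hAB' s t f] at HAB
  have iA := integrable_comp_twoValued_prod (μ := μ) hA' s t hf
  have iB := integrable_comp_twoValued_prod (μ := μ) hB' s t hf
  have i0 := integrable_comp_twoValued_prod (μ := μ) MeasurableSet.empty s t hf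
  have jA := integrable_comp_twoValued (κ := ν) hA' s t hg
  have jB := integrable_comp_twoValued (κ := ν) hB' s t hg
  have j0 := integrable_comp_twoValued (κ := ν) MeasurableSet.empty s t hg
  set k := f (s, t) + f (t, s) - f (s, s) - f (t, t)
  have k1 : Integrable ((A' ×ˢ B').indicator fun _ => k) μ :=
    (integrable_const k).indicator (hA'.prod hB')
  have k2 : Integrable ((B' ×ˢ A').indicator fun _ => k) μ :=
    (integrable_const k).indicator (hB'.prod hA')
  have e1 := integral_sub ((iA.add iB).sub i0) (k1.add k2)
  have e2 := integral_sub (iA.add iB) i0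
  have e3 := integral_sub (jA.add jB) j0
  simp only [Pi.add_apply, Pi.sub_apply] at e1 e2 e3
  rw [e1, e2, e3, integral_add iA iB, integral_add k1 k2, integral_add jA jB,
    integral_indicator_const _ (hA'.prod hB'), integral_indicator_const _ (hB'.prod hA'),
    smul_eq_mul, smul_eq_mul] at HAB
  linarith

end SecondDifference

/-! ### The exponent is two -/

section Exponent

variable {d : ℕ} {Ω : Opens (EuclideanSpace ℝ (Fin d))}

theorem exists_volume_restrict_ball_eq (hd : d ≠ 0)
    (hΩ : Bornology.IsBounded (Ω : Set (EuclideanSpace ℝ (Fin d)))) {v : ℝ} (hv0 : 0 ≤ v)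
    (hv : v ≤ volume.real (Ω : Set (EuclideanSpace ℝ (Fin d)))) :
    ∃ r : ℝ, (volume.restrict (Ω : Set (EuclideanSpace ℝ (Fin d)))).real (Metric.ball 0 r) = v := by
  set κ := volume.restrict (Ω : Set (EuclideanSpace ℝ (Fin d)))
  obtain ⟨R, hR⟩ := hΩ.subset_ball 0
  set R' := max R 0
  have hR' : (Ω : Set (EuclideanSpace ℝ (Fin d))) ⊆ Metric.ball 0 R' :=
    hR.trans (Metric.ball_subset_ball (le_max_left _ _))
  have hfin : ∀ r, volume (Metric.ball (0 : EuclideanSpace ℝ (Fin d)) r) ≠ ⊤ := fun r =>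
    measure_ball_lt_top.ne
  have hle : κ ≤ volume := Measure.restrict_le_self
  have hκfin : ∀ r, κ (Metric.ball (0 : EuclideanSpace ℝ (Fin d)) r) ≠ ⊤ := fun r =>
    ((hle _).trans_lt measure_ball_lt_top).ne
  set w : ℝ → ℝ := fun r => r ^ d * volume.real (Metric.ball (0 : EuclideanSpace ℝ (Fin d)) 1)
  have hw : ∀ r, 0 ≤ r → volume.real (Metric.ball (0 : EuclideanSpace ℝ (Fin d)) r) = w r := by
    intro r hr
    rcases hr.eq_or_lt with rfl | hr
    · simp [w, zero_pow hd]
    · rw [Measure.real, Measure.addHaar_ball_of_pos _ _ hr, finrank_euclideanSpace_fin,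
        ENNReal.toReal_mul, ENNReal.toReal_ofReal (by positivity)]
      rfl
  have hinc : ∀ a b, 0 ≤ a → a ≤ b →
      |κ.real (Metric.ball 0 b) - κ.real (Metric.ball 0 a)| ≤ |w b - w a| := by
    intro a b ha hab
    have hsub : Metric.ball (0 : EuclideanSpace ℝ (Fin d)) a ⊆ Metric.ball 0 b :=
      Metric.ball_subset_ball hab
    rw [← hw a ha, ← hw b (ha.trans hab), ← measureReal_sdiff hsub Metric.isOpen_ball.measurableSet
      (hfin b), ← measureReal_sdiff hsub Metric.isOpen_ball.measurableSet (hκfin b),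
      abs_of_nonneg measureReal_nonneg, abs_of_nonneg measureReal_nonneg]
    exact ENNReal.toReal_mono (measure_ne_top_of_subset Set.sdiff_subset (hfin b)) (hle _)
  have hwc : Continuous w := by fun_prop
  have hcont : ContinuousOn (fun r => κ.real (Metric.ball 0 r)) (Set.Icc 0 R') := by
    intro a ha
    have h0 : Tendsto (fun b => |w b - w a|) (𝓝[Set.Icc 0 R'] a) (𝓝 0) := by
      have := ((hwc.sub (continuous_const (y := w a))).abs.tendsto a).mono_left
        (nhdsWithin_le_nhds (s := Set.Icc 0 R'))
      simpa using this
    refine tendsto_iff_dist_tendsto_zero.2 (squeeze_zero' (Eventually.of_forall fun _ =>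
      dist_nonneg) ?_ h0)
    filter_upwards [self_mem_nhdsWithin] with b hb
    rw [Real.dist_eq]
    rcases le_total a b with hab | hab
    · exact hinc a b ha.1 hab
    · rw [abs_sub_comm, abs_sub_comm (w b)]
      exact hinc b a hb.1 hab
  have h0 : κ.real (Metric.ball 0 0) = 0 := by simp
  have h1 : κ.real (Metric.ball 0 R') = volume.real (Ω : Set (EuclideanSpace ℝ (Fin d))) := by
    rw [measureReal_restrict_apply Metric.isOpen_ball.measurableSet, Set.inter_eq_right.2 hR']
  obtain ⟨r, -, hr⟩ := intermediate_value_Icc (le_max_right R 0) hcont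
    (show v ∈ Set.Icc _ _ from ⟨by rw [h0]; exact hv0, by rw [h1]; exact hv⟩)
  exact ⟨r, hr⟩

/-- Three disjoint sets each carrying a quarter of the volume of `Ω`. -/
theorem exists_disjoint_quarters (hd : d ≠ 0)
    (hΩ : Bornology.IsBounded (Ω : Set (EuclideanSpace ℝ (Fin d))))
    [IsFiniteMeasure (volume.restrict (Ω : Set (EuclideanSpace ℝ (Fin d))))]
    (hV : 0 < volume.real (Ω : Set (EuclideanSpace ℝ (Fin d)))) :
    ∃ A B C : Set (EuclideanSpace ℝ (Fin d)), MeasurableSet A ∧ MeasurableSet B ∧ MeasurableSet C ∧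
      Disjoint A B ∧ Disjoint A C ∧ Disjoint B C ∧
      (volume.restrict (Ω : Set (EuclideanSpace ℝ (Fin d)))).real A =
        volume.real (Ω : Set (EuclideanSpace ℝ (Fin d))) / 4 ∧
      (volume.restrict (Ω : Set (EuclideanSpace ℝ (Fin d)))).real B =
        volume.real (Ω : Set (EuclideanSpace ℝ (Fin d))) / 4 ∧
      (volume.restrict (Ω : Set (EuclideanSpace ℝ (Fin d)))).real C =
        volume.real (Ω : Set (EuclideanSpace ℝ (Fin d))) / 4 := by
  set κ := volume.restrict (Ω : Set (EuclideanSpace ℝ (Fin d)))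
  set V := volume.real (Ω : Set (EuclideanSpace ℝ (Fin d)))
  obtain ⟨r₁, h₁⟩ := exists_volume_restrict_ball_eq hd hΩ (v := V / 4) (by positivity)
    (by linarith)
  obtain ⟨r₂, h₂⟩ := exists_volume_restrict_ball_eq hd hΩ (v := V / 2) (by positivity)
    (by linarith)
  obtain ⟨r₃, h₃⟩ := exists_volume_restrict_ball_eq hd hΩ (v := 3 * V / 4) (by positivity)
    (by linarith)
  have hmono : ∀ a b, κ.real (Metric.ball 0 a) < κ.real (Metric.ball 0 b) →
      Metric.ball (0 : EuclideanSpace ℝ (Fin d)) a ⊆ Metric.ball 0 b := by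
    intro a b hab
    refine Metric.ball_subset_ball (le_of_not_ge fun h => ?_)
    exact hab.not_ge (measureReal_mono (Metric.ball_subset_ball h))
  have h12 := hmono r₁ r₂ (by rw [h₁, h₂]; linarith)
  have h23 := hmono r₂ r₃ (by rw [h₂, h₃]; linarith)
  have hm : ∀ r, MeasurableSet (Metric.ball (0 : EuclideanSpace ℝ (Fin d)) r) := fun r =>
    Metric.isOpen_ball.measurableSet
  refine ⟨Metric.ball 0 r₁, Metric.ball 0 r₂ \ Metric.ball 0 r₁,
    Metric.ball 0 r₃ \ Metric.ball 0 r₂, hm _, (hm _).diff (hm _), (hm _).diff (hm _),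
    Set.disjoint_sdiff_right, Set.disjoint_sdiff_right.mono_left h12,
    Set.disjoint_sdiff_right.mono_left Set.sdiff_subset, h₁, ?_, ?_⟩
  · rw [measureReal_sdiff h12 (hm _), h₁, h₂]
    ring
  · rw [measureReal_sdiff h23 (hm _), h₂, h₃]
    ring

/-- Equality at the midpoint of `1` and `T` in the convexity inequality for `x ↦ x^r` forces
`r = 1`. -/
theorem eq_one_of_one_add_rpow_eq {r : ℝ} (hr : 0 < r)
    (h : (1 + (3 : ℝ) ^ r⁻¹) ^ r = 2 ^ (r + 1)) : r = 1 := by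
  set T : ℝ := 3 ^ r⁻¹
  have hTr : T ^ r = 3 := Real.rpow_inv_rpow (by norm_num) hr.ne'
  have hT0 : 0 < T := by positivity
  have hT1 : (1 : ℝ) ≠ T := by
    intro h1
    rw [← h1, Real.one_rpow] at hTr
    norm_num at hTr
  have hmid : ((1 / 2 : ℝ) • (1 : ℝ) + (1 / 2 : ℝ) • T) ^ r = 2 := by
    have e : (1 / 2 : ℝ) • (1 : ℝ) + (1 / 2 : ℝ) • T = (1 + T) / 2 := by
      simp only [smul_eq_mul]; ring
    rw [e, Real.div_rpow (by positivity) (by norm_num), h, Real.rpow_add_one (by norm_num)]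
    field_simp
  have hend : (1 / 2 : ℝ) • (1 : ℝ) ^ r + (1 / 2 : ℝ) • T ^ r = 2 := by
    rw [hTr, Real.one_rpow]
    norm_num
  rcases lt_trichotomy r 1 with h1 | h1 | h1
  · have := (Real.strictConcaveOn_rpow hr h1).2 (Set.mem_Ici.2 zero_le_one)
      (Set.mem_Ici.2 hT0.le) hT1 (by norm_num : (0 : ℝ) < 1 / 2)
      (by norm_num : (0 : ℝ) < 1 / 2) (by norm_num)
    linarith
  · exact h1
  · have := (strictConvexOn_rpow h1).2 (Set.mem_Ici.2 zero_le_one)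
      (Set.mem_Ici.2 hT0.le) hT1 (by norm_num : (0 : ℝ) < 1 / 2)
      (by norm_num : (0 : ℝ) < 1 / 2) (by norm_num)
    linarith

variable {p : ℝ} [hp : Fact (1 < p)]
  [IsFiniteMeasure (volume.restrict (Ω : Set (EuclideanSpace ℝ (Fin d))))]

theorem lpOsc_indicator_half {α : Type*} {m : MeasurableSpace α} {κ : Measure α}
    [IsFiniteMeasure κ] {A : Set α} (hA : MeasurableSet A)
    (h : κ.real A = κ.real Set.univ / 2) :
    lpOsc κ p (twoValued A 1 0) = κ.real Set.univ * 2⁻¹ ^ p := by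
  have hsum : κ.real A + κ.real Aᶜ = κ.real Set.univ := measureReal_add_measureReal_compl hA
  have hc : κ.real Aᶜ = κ.real Set.univ / 2 := by linarith
  rw [lpOsc_twoValued_one_zero hp.out hA (x₀ := 2⁻¹) (y₀ := 2⁻¹) (by norm_num) (by norm_num)
    (by norm_num) (by rw [h, hc]), hc]
  have : (2⁻¹ : ℝ) ^ p = 2⁻¹ ^ (p - 1) * 2⁻¹ := by
    rw [← Real.rpow_add_one (by norm_num), sub_add_cancel]
  rw [this]
  ring

theorem lpOsc_indicator_quarter {α : Type*} {m : MeasurableSpace α} {κ : Measure α}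
    [IsFiniteMeasure κ] {A : Set α} (hA : MeasurableSet A)
    (h : κ.real A = κ.real Set.univ / 4 ∨ κ.real A = 3 * κ.real Set.univ / 4) :
    lpOsc κ p (twoValued A 1 0) =
      3 * κ.real Set.univ / 4 * ((1 + (3 : ℝ) ^ (p - 1)⁻¹)⁻¹) ^ (p - 1) := by
  have hp1 : 0 < p - 1 := sub_pos.2 hp.out
  have hsum : κ.real A + κ.real Aᶜ = κ.real Set.univ := measureReal_add_measureReal_compl hA
  set V := κ.real Set.univ
  set T : ℝ := 3 ^ (p - 1)⁻¹
  have hT0 : 0 < T := by positivity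
  have hTr : T ^ (p - 1) = 3 := Real.rpow_inv_rpow (by norm_num) hp1.ne'
  have hx : 0 < T * (1 + T)⁻¹ := by positivity
  have hy : 0 < (1 + T)⁻¹ := by positivity
  have hxy : T * (1 + T)⁻¹ + (1 + T)⁻¹ = 1 := by field_simp; ring
  have hxr : (T * (1 + T)⁻¹) ^ (p - 1) = 3 * (1 + T)⁻¹ ^ (p - 1) := by
    rw [Real.mul_rpow hT0.le hy.le, hTr]
  rcases h with h | h
  · have hc : κ.real Aᶜ = 3 * V / 4 := by linarith
    rw [lpOsc_twoValued_one_zero hp.out hA hx hy hxy (by rw [hxr, h, hc]; ring), hc]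
  · have hc : κ.real Aᶜ = V / 4 := by linarith
    rw [lpOsc_twoValued_one_zero hp.out hA hy hx (by linarith) (by rw [hxr, h, hc]; ring), hc, hxr]
    ring

/-- The distance to the constants of the indicator of a set of volume `θ|Ω|` would have to be
quadratic in `θ`; comparing `θ = 1/4, 1/2, 3/4` excludes all exponents but `2`. -/
theorem exponent_eq_two (hd : d ≠ 0)
    (hΩ : Bornology.IsBounded (Ω : Set (EuclideanSpace ℝ (Fin d))))
    (hV : 0 < volume.real (Ω : Set (EuclideanSpace ℝ (Fin d))))
    {f : ℝ × ℝ → ℝ} {g : ℝ → ℝ} {μ : Measure (Ω × Ω)}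
    {ν : Measure Ω} [IsFiniteMeasure μ] [IsFiniteMeasure ν] (hf : Continuous f) (hg : Continuous g)
    (H : ∀ φ : 𝓓(Ω, ℝ), (∫ z : Ω × Ω, f (φ z.1, φ z.2) ∂μ) + (∫ x : Ω, g (φ x) ∂ν) =
      lpOsc (volume.restrict (Ω : Set (EuclideanSpace ℝ (Fin d)))) p φ) : p = 2 := by
  obtain ⟨A, B, C, hA, hB, hC, hAB, hAC, hBC, vA, vB, vC⟩ := exists_disjoint_quarters hd hΩ hV
  have hVu : (volume.restrict (Ω : Set (EuclideanSpace ℝ (Fin d)))).real Set.univ =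
      volume.real (Ω : Set (EuclideanSpace ℝ (Fin d))) := by
    rw [measureReal_restrict_apply_univ]
  rw [← hVu] at vA vB vC hV
  set κ := volume.restrict (Ω : Set (EuclideanSpace ℝ (Fin d)))
  set V := κ.real Set.univ
  have vAB : κ.real (A ∪ B) = V / 2 := by rw [measureReal_union hAB hB, vA, vB]; ring
  have vAC : κ.real (A ∪ C) = V / 2 := by rw [measureReal_union hAC hC, vA, vC]; ring
  have vBC : κ.real (B ∪ C) = V / 2 := by rw [measureReal_union hBC hC, vB, vC]; ring
  have hA_BC : Disjoint A (B ∪ C) := hAB.union_right hAC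
  have vABC : κ.real (A ∪ (B ∪ C)) = 3 * V / 4 := by
    rw [measureReal_union hA_BC (hB.union hC), vA, vBC]; ring
  -- the interaction of `A` with `B ∪ C` is the sum of those with `B` and with `C`
  have D1 := lpOsc_twoValued_union hf hg H hA hB hAB 1 0
  have D2 := lpOsc_twoValued_union hf hg H hA hC hAC 1 0
  have D3 := lpOsc_twoValued_union hf hg H hA (hB.union hC) hA_BC 1 0
  have hA' : MeasurableSet (Subtype.val ⁻¹' A : Set Ω) := measurable_subtype_coe hA
  have hC' : MeasurableSet (Subtype.val ⁻¹' C : Set Ω) := measurable_subtype_coe hC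
  have hBC' : Disjoint (Subtype.val ⁻¹' B : Set Ω) (Subtype.val ⁻¹' C) := hBC.preimage _
  rw [Set.preimage_union, Set.prod_union, Set.union_prod,
    measureReal_union (Set.disjoint_prod.2 (Or.inr hBC')) (hA'.prod hC'),
    measureReal_union (Set.disjoint_prod.2 (Or.inl hBC')) (hC'.prod hA'),
    lpOsc_indicator_quarter (hA.union (hB.union hC)) (Or.inr vABC),
    lpOsc_indicator_quarter hA (Or.inl vA), lpOsc_indicator_half (hB.union hC) vBC] at D3
  rw [lpOsc_indicator_quarter hA (Or.inl vA), lpOsc_indicator_quarter hB (Or.inl vB),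
    lpOsc_indicator_half (hA.union hB) vAB] at D1
  rw [lpOsc_indicator_quarter hA (Or.inl vA), lpOsc_indicator_quarter hC (Or.inl vC),
    lpOsc_indicator_half (hA.union hC) vAC] at D2
  have hp1 : 0 < p - 1 := sub_pos.2 hp.out
  have key : V * ((1 + (3 : ℝ) ^ (p - 1)⁻¹)⁻¹) ^ (p - 1) = V * 2⁻¹ ^ p := by linarith
  have key2 := mul_left_cancel₀ hV.ne' key
  rw [Real.inv_rpow (by positivity), Real.inv_rpow (by norm_num), inv_inj] at key2
  have := eq_one_of_one_add_rpow_eq hp1 (by rw [key2, sub_add_cancel])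
  linarith

end Exponent

/-! ### Identification of the kernel and of the measure -/

section Identification

/-- Finite measures on a product which agree on products of disjoint sets agree off the
diagonal, since the complement of the diagonal is a countable union of open boxes `U × W` with `U`
and `W` disjoint. -/
theorem restrict_compl_diagonal_eq {α : Type*} [TopologicalSpace α] [T2Space α]
    [SecondCountableTopology α] [MeasurableSpace α] [BorelSpace α] {μ₁ μ₂ : Measure (α × α)}
    [IsFiniteMeasure μ₁] (h : ∀ A B : Set α, MeasurableSet A → MeasurableSet B → Disjoint A B →
      μ₁ (A ×ˢ B) = μ₂ (A ×ˢ B)) :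
    μ₁.restrict (Set.diagonal α)ᶜ = μ₂.restrict (Set.diagonal α)ᶜ := by
  have hb := isBasis_countableBasis α
  set I : Set (Set α × Set α) :=
    {q | q ∈ countableBasis α ×ˢ countableBasis α ∧ Disjoint q.1 q.2}
  have hI : I.Countable := ((countable_countableBasis α).prod (countable_countableBasis α)).mono
    fun q hq => hq.1
  have : Countable I := hI.to_subtype
  have hcover : (Set.diagonal α)ᶜ = ⋃ q : I, q.1.1 ×ˢ q.1.2 := by
    ext ⟨x, y⟩
    simp only [Set.mem_compl_iff, Set.mem_diagonal_iff, Set.mem_iUnion]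
    constructor
    · intro hxy
      obtain ⟨u, v, hu, hv, hxu, hyv, huv⟩ := t2_separation hxy
      obtain ⟨U, hU, hxU, hUu⟩ := hb.exists_subset_of_mem_open hxu hu
      obtain ⟨W, hW, hyW, hWv⟩ := hb.exists_subset_of_mem_open hyv hv
      exact ⟨⟨(U, W), ⟨hU, hW⟩, huv.mono hUu hWv⟩, hxU, hyW⟩
    · rintro ⟨q, hx, hy⟩ rfl
      exact Set.disjoint_left.1 q.2.2 hx hy
  rw [hcover, Measure.restrict_iUnion_congr]
  rintro ⟨⟨U, W⟩, ⟨hU, hW⟩, hd⟩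
  have hUm : MeasurableSet U := (hb.isOpen hU).measurableSet
  have hWm : MeasurableSet W := (hb.isOpen hW).measurableSet
  refine Measure.ext_prod fun {A B} hA hB => ?_
  rw [Measure.restrict_apply (hA.prod hB), Measure.restrict_apply (hA.prod hB),
    Set.prod_inter_prod]
  exact h _ _ (hA.inter hUm) (hB.inter hWm)
    (hd.mono Set.inter_subset_right Set.inter_subset_right)

variable {d : ℕ} {Ω : Opens (EuclideanSpace ℝ (Fin d))}

theorem lebesgueOn_apply (A : Set Ω) :
    lebesgueOn Ω A = volume (Subtype.val '' A : Set (EuclideanSpace ℝ (Fin d))) :=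
  (MeasurableEmbedding.subtype_coe Ω.isOpen.measurableSet).comap_apply _ _

theorem volume_restrict_eq_lebesgueOn_preimage {A : Set (EuclideanSpace ℝ (Fin d))}
    (hA : MeasurableSet A) :
    volume.restrict (Ω : Set (EuclideanSpace ℝ (Fin d))) A =
      lebesgueOn Ω (Subtype.val ⁻¹' A) := by
  rw [lebesgueOn_apply, Measure.restrict_apply hA, Set.inter_comm]
  exact congrArg volume (Subtype.image_preimage_coe _ A).symm

theorem isFiniteMeasure_lebesgueOn
    [IsFiniteMeasure (volume.restrict (Ω : Set (EuclideanSpace ℝ (Fin d))))] :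
    IsFiniteMeasure (lebesgueOn Ω) := by
  refine ⟨?_⟩
  have := volume_restrict_eq_lebesgueOn_preimage (Ω := Ω) MeasurableSet.univ
  rw [Set.preimage_univ] at this
  rw [← this]
  exact measure_lt_top _ _

theorem lebesgueOnProd_diagonal (hd : d ≠ 0)
    [IsFiniteMeasure (volume.restrict (Ω : Set (EuclideanSpace ℝ (Fin d))))] :
    lebesgueOnProd Ω (Set.diagonal Ω) = 0 := by
  have : IsFiniteMeasure (lebesgueOn Ω) := isFiniteMeasure_lebesgueOn
  have : Nonempty (Fin d) := ⟨⟨0, Nat.pos_of_ne_zero hd⟩⟩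
  rw [lebesgueOnProd, Measure.measure_prod_null measurableSet_diagonal]
  refine ae_of_all _ fun x => ?_
  have : Prod.mk x ⁻¹' Set.diagonal Ω = {x} := by
    ext y
    simp [eq_comm]
  beta_reduce
  rw [this, lebesgueOn_apply, Set.image_singleton, measure_singleton, Pi.zero_apply]

variable [IsFiniteMeasure (volume.restrict (Ω : Set (EuclideanSpace ℝ (Fin d))))]
  {f : ℝ × ℝ → ℝ} {g : ℝ → ℝ} {μ : Measure (Ω × Ω)} {ν : Measure Ω}
  [IsFiniteMeasure μ] [IsFiniteMeasure ν]

theorem kernel_mul_measure_eq [hp : Fact ((1 : ℝ) < 2)]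
    (hV : 0 < volume.real (Ω : Set (EuclideanSpace ℝ (Fin d))))
    (hf : Continuous f) (hg : Continuous g)
    (H : ∀ φ : 𝓓(Ω, ℝ), (∫ z : Ω × Ω, f (φ z.1, φ z.2) ∂μ) + (∫ x : Ω, g (φ x) ∂ν) =
      lpOsc (volume.restrict (Ω : Set (EuclideanSpace ℝ (Fin d)))) 2 φ)
    {A B : Set (EuclideanSpace ℝ (Fin d))} (hA : MeasurableSet A) (hB : MeasurableSet B)
    (hAB : Disjoint A B) (s t : ℝ) :
    (f (s, t) + f (t, s) - f (s, s) - f (t, t)) *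
        (μ.real ((Subtype.val ⁻¹' A) ×ˢ (Subtype.val ⁻¹' B)) +
          μ.real ((Subtype.val ⁻¹' B) ×ˢ (Subtype.val ⁻¹' A))) =
      2 * |s - t| ^ 2 * ((volume.restrict (Ω : Set (EuclideanSpace ℝ (Fin d)))).real A *
        (volume.restrict (Ω : Set (EuclideanSpace ℝ (Fin d)))).real B /
          volume.real (Ω : Set (EuclideanSpace ℝ (Fin d)))) := by
  have hVu : (volume.restrict (Ω : Set (EuclideanSpace ℝ (Fin d)))).real Set.univ =
      volume.real (Ω : Set (EuclideanSpace ℝ (Fin d))) := by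
    rw [measureReal_restrict_apply_univ]
  have D := lpOsc_twoValued_union hf hg H hA hB hAB s t
  rw [← hVu] at hV ⊢
  set κ := volume.restrict (Ω : Set (EuclideanSpace ℝ (Fin d)))
  rw [lpOsc_two_twoValued (hA.union hB) s t hV, lpOsc_two_twoValued hA s t hV,
    lpOsc_two_twoValued hB s t hV, measureReal_compl (hA.union hB), measureReal_compl hA,
    measureReal_compl hB, measureReal_union hAB hB] at D
  rw [← sub_eq_zero] at D ⊢
  rw [← D]
  field_simp
  ring

/-- The kernel of a representation is quadratic up to antisymmetric and diagonal parts, and the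
symmetrised measure is a multiple of Lebesgue measure off the diagonal. -/
theorem exists_kernel_and_measure [hp : Fact ((1 : ℝ) < 2)] (hd : d ≠ 0)
    (hΩ : Bornology.IsBounded (Ω : Set (EuclideanSpace ℝ (Fin d))))
    (hV : 0 < volume.real (Ω : Set (EuclideanSpace ℝ (Fin d))))
    (hf : Continuous f) (hg : Continuous g)
    (H : ∀ φ : 𝓓(Ω, ℝ), (∫ z : Ω × Ω, f (φ z.1, φ z.2) ∂μ) + (∫ x : Ω, g (φ x) ∂ν) =
      lpOsc (volume.restrict (Ω : Set (EuclideanSpace ℝ (Fin d)))) 2 φ) :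
    ∃ c : ℝ, 0 < c ∧
      (∀ s t : ℝ, f (s, t) + f (t, s) - f (s, s) - f (t, t) = 2 * c * |s - t| ^ 2) ∧
      (∀ E : Set (Ω × Ω), MeasurableSet E → Disjoint E (Set.diagonal Ω) →
        μ E + μ (Prod.swap ⁻¹' E) =
          ENNReal.ofReal (1 / (c * volume.real (Ω : Set (EuclideanSpace ℝ (Fin d))))) *
            lebesgueOnProd Ω E) := by
  have : IsFiniteMeasure (lebesgueOn Ω) := isFiniteMeasure_lebesgueOn
  have key := fun {A B : Set (EuclideanSpace ℝ (Fin d))} (hA : MeasurableSet A)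
    (hB : MeasurableSet B) (hAB : Disjoint A B) (s t : ℝ) =>
    kernel_mul_measure_eq hV hf hg H hA hB hAB s t
  obtain ⟨A, B, -, hA, hB, -, hAB, -, -, vA, vB, -⟩ := exists_disjoint_quarters hd hΩ hV
  set V := volume.real (Ω : Set (EuclideanSpace ℝ (Fin d)))
  set κ := volume.restrict (Ω : Set (EuclideanSpace ℝ (Fin d)))
  have hk := key hA hB hAB
  rw [vA, vB] at hk
  -- `l > 0`, as the second difference for `s = 1`, `t = 0` does not vanish on `A`, `B`
  set l := μ.real ((Subtype.val ⁻¹' A) ×ˢ (Subtype.val ⁻¹' B)) +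
    μ.real ((Subtype.val ⁻¹' B) ×ˢ (Subtype.val ⁻¹' A))
  have hl : 0 < l := by
    refine lt_of_le_of_ne (add_nonneg measureReal_nonneg measureReal_nonneg) fun h0 => ?_
    have h10 := hk 1 0
    rw [← h0, mul_zero] at h10
    have : 0 < 2 * |(1 : ℝ) - 0| ^ 2 * (V / 4 * (V / 4) / V) := by
      rw [sub_zero, abs_one]
      positivity
    linarith
  have hc : 0 < V / 16 / l := by positivity
  set c := V / 16 / l with hcdef
  have hkc : ∀ s t : ℝ, f (s, t) + f (t, s) - f (s, s) - f (t, t) = 2 * c * |s - t| ^ 2 := by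
    intro s t
    refine mul_right_cancel₀ hl.ne' ((hk s t).trans ?_)
    rw [hcdef]
    field_simp
    norm_num
  refine ⟨c, hc, hkc, ?_⟩
  have hrect : ∀ A' B' : Set Ω, MeasurableSet A' → MeasurableSet B' → Disjoint A' B' →
      (μ + μ.map Prod.swap) (A' ×ˢ B') =
        (ENNReal.ofReal (1 / (c * V)) • lebesgueOnProd Ω) (A' ×ˢ B') := by
    intro A' B' hA' hB' hAB'
    have emb := MeasurableEmbedding.subtype_coe (Ω.isOpen.measurableSet)
    have hA : MeasurableSet (Subtype.val '' A' : Set (EuclideanSpace ℝ (Fin d))) :=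
      emb.measurableSet_image.2 hA'
    have hB : MeasurableSet (Subtype.val '' B' : Set (EuclideanSpace ℝ (Fin d))) :=
      emb.measurableSet_image.2 hB'
    have h10 := key hA hB ((Set.disjoint_image_iff Subtype.val_injective).2 hAB') 1 0
    have vA : κ.real (Subtype.val '' A') = (lebesgueOn Ω).real A' := by
      rw [measureReal_def, volume_restrict_eq_lebesgueOn_preimage hA,
        Set.preimage_image_eq _ Subtype.val_injective, measureReal_def]
    have vB : κ.real (Subtype.val '' B') = (lebesgueOn Ω).real B' := by
      rw [measureReal_def, volume_restrict_eq_lebesgueOn_preimage hB,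
        Set.preimage_image_eq _ Subtype.val_injective, measureReal_def]
    rw [hkc, vA, vB, Set.preimage_image_eq _ Subtype.val_injective,
      Set.preimage_image_eq _ Subtype.val_injective, sub_zero, abs_one] at h10
    rw [Measure.add_apply, Measure.map_apply measurable_swap (hA'.prod hB'),
      Set.preimage_swap_prod, Measure.smul_apply, lebesgueOnProd, Measure.prod_prod,
      smul_eq_mul, ← ofReal_measureReal (μ := μ), ← ofReal_measureReal (μ := μ),
      ← ofReal_measureReal (μ := lebesgueOn Ω), ← ofReal_measureReal (μ := lebesgueOn Ω),
      ← ENNReal.ofReal_add measureReal_nonneg measureReal_nonneg,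
      ← ENNReal.ofReal_mul measureReal_nonneg, ← ENNReal.ofReal_mul (by positivity)]
    congr 1
    have h2c : 2 * c * 1 ^ 2 ≠ 0 := by positivity
    refine mul_left_cancel₀ h2c (h10.trans ?_)
    field_simp
  intro E hE hdisj
  have hsub : E ⊆ (Set.diagonal Ω)ᶜ := Set.subset_compl_iff_disjoint_right.2 hdisj
  have hfinal := congrArg (fun m : Measure (Ω × Ω) => m E) (restrict_compl_diagonal_eq hrect)
  simp only [Measure.restrict_apply hE, Set.inter_eq_left.2 hsub] at hfinal
  rwa [Measure.add_apply, Measure.map_apply measurable_swap hE, Measure.smul_apply,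
    smul_eq_mul] at hfinal

theorem measure_eq_zero_or_eq_zero {p : ℝ} [hp : Fact (1 < p)]
    (hf : Continuous f) (hg : Continuous g) (hdiag : ∀ s : ℝ, f (s, s) = 0)
    (H : ∀ φ : 𝓓(Ω, ℝ), (∫ z : Ω × Ω, f (φ z.1, φ z.2) ∂μ) + (∫ x : Ω, g (φ x) ∂ν) =
      lpOsc (volume.restrict (Ω : Set (EuclideanSpace ℝ (Fin d)))) p φ) : ν = 0 ∨ g = 0 := by
  by_cases hν : ν = 0
  · exact Or.inl hν
  right
  funext t
  -- the identity for the constant function `t` reads `g(t) ν(Ω) = 0`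
  have h := integral_twoValued_eq_lpOsc hf hg H MeasurableSet.empty t t
  rw [lpOsc_twoValued_empty (one_pos.trans hp.out)] at h
  simp only [twoValued, Set.mem_empty_iff_false, if_false, hdiag, integral_zero, zero_add,
    integral_const, smul_eq_mul, mul_eq_zero] at h
  refine h.resolve_left fun h0 => hν ?_
  rwa [measureReal_eq_zero_iff, Measure.measure_univ_eq_zero] at h0

end Identification

/-! ### The canonical representation for exponent two -/

section Variance

theorem lpOsc_two_eq_integral_prod {α : Type*} {m : MeasurableSpace α} {l : Measure α}
    [IsFiniteMeasure l] (hl : 0 < l.real Set.univ) {u : α → ℝ} (hu : Integrable u l)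
    (hu2 : Integrable (fun x => u x ^ 2) l) :
    lpOsc l 2 u = 1 / (2 * l.real Set.univ) * ∫ z, |u z.1 - u z.2| ^ 2 ∂(l.prod l) := by
  set V := l.real Set.univ
  have h1 : ∀ c : ℝ, ∫ x, |u x - c| ^ (2 : ℝ) ∂l =
      (∫ x, u x ^ 2 ∂l) - 2 * c * (∫ x, u x ∂l) + V * c ^ 2 := by
    intro c
    have e : ∀ x, |u x - c| ^ (2 : ℝ) = u x ^ 2 - 2 * c * u x + c ^ 2 := by
      intro x
      rw [Real.rpow_two, sq_abs]
      ring
    simp only [e]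
    have := integral_add (hu2.sub (hu.const_mul (2 * c))) (integrable_const (μ := l) (c ^ 2))
    simp only [Pi.sub_apply] at this
    rw [this, integral_sub hu2 (hu.const_mul (2 * c)), integral_const_mul, integral_const,
      smul_eq_mul]
  have h2 : ∫ z, |u z.1 - u z.2| ^ 2 ∂(l.prod l) =
      2 * V * (∫ x, u x ^ 2 ∂l) - 2 * (∫ x, u x ∂l) ^ 2 := by
    have e : ∀ z : α × α, |u z.1 - u z.2| ^ 2 =
        u z.1 ^ 2 + u z.2 ^ 2 - 2 * (u z.1 * u z.2) := by
      intro z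
      rw [sq_abs]
      ring
    simp only [e]
    have i1 := hu2.comp_fst l
    have i2 := hu2.comp_snd l
    have i3 := (hu.mul_prod hu).const_mul 2
    have := integral_sub (i1.add i2) i3
    simp only [Pi.add_apply] at this
    rw [this, integral_add i1 i2, integral_const_mul, integral_prod_mul,
      integral_fun_fst (fun x => u x ^ 2), integral_fun_snd (fun x => u x ^ 2), smul_eq_mul]
    ring
  have hmin : ∀ c : ℝ, (∫ x, u x ^ 2 ∂l) - 2 * c * (∫ x, u x ∂l) + V * c ^ 2 =
      (∫ x, u x ^ 2 ∂l) - (∫ x, u x ∂l) ^ 2 / V + V * (c - (∫ x, u x ∂l) / V) ^ 2 := by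
    intro c
    field_simp
    ring
  rw [lpOsc_eq_of_forall_le (c₀ := (∫ x, u x ∂l) / V), h1, h2, hmin, sub_self]
  · field_simp
    ring
  · intro c
    rw [h1, h1, hmin, hmin c, sub_self]
    have : 0 ≤ V * (c - (∫ x, u x ∂l) / V) ^ 2 := by positivity
    linarith

theorem lpOsc_lebesgueOn {d : ℕ} {Ω : Opens (EuclideanSpace ℝ (Fin d))} (p : ℝ)
    (u : EuclideanSpace ℝ (Fin d) → ℝ) :
    lpOsc (lebesgueOn Ω) p (fun x => u x) =
      lpOsc (volume.restrict (Ω : Set (EuclideanSpace ℝ (Fin d)))) p u := by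
  unfold lpOsc
  congr 1
  funext c
  exact integral_subtype_comap Ω.isOpen.measurableSet fun x => |u x - c| ^ p

end Variance

end

/-! ### The representation theorem -/

theorem mainTheorem3 {d : ℕ} (Ω : Opens (EuclideanSpace ℝ (Fin d)))
    (hΩconn : IsConnected (Ω : Set (EuclideanSpace ℝ (Fin d))))
    (hΩbdd : Bornology.IsBounded (Ω : Set (EuclideanSpace ℝ (Fin d))))
    (hΩ0 : (0 : EuclideanSpace ℝ (Fin d)) ∈ Ω)
    (p : ℝ) [Fact (1 < p)] (hpd : p ≤ d)
    (ε : ℕ → ℝ) (hεpos : ∀ k, 0 < ε k) (hεlim : Tendsto ε atTop (𝓝 0))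
    (F : W0 Ω p → EReal)
    (hF : IsWeakGammaLimit (fun k (u : W0 Ω p) => ((ballEnergy (ε k) u : ℝ) : EReal)) F) :
    -- every representation forces `p = 2`, and is the canonical one up to normalization
    (∀ (f : ℝ × ℝ → ℝ) (g : ℝ → ℝ) (μ : Measure (Ω × Ω)) (ν : Measure Ω),
      Continuous f → Continuous g → IsFiniteMeasure μ → IsFiniteMeasure ν →
      IsRepresentedBy F f g μ ν →
        p = 2 ∧
        (∃ c : ℝ, 0 < c ∧
          (∀ s t : ℝ, f (s, t) + f (t, s) - f (s, s) - f (t, t) = 2 * c * |s - t| ^ 2) ∧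
          (∀ E : Set (Ω × Ω), MeasurableSet E → Disjoint E (Set.diagonal Ω) →
            μ E + μ (Prod.swap ⁻¹' E) =
              ENNReal.ofReal (1 / (c * volume.real (Ω : Set (EuclideanSpace ℝ (Fin d))))) *
                lebesgueOnProd Ω E)) ∧
        ((∀ s t : ℝ, f (s, t) = f (t, s)) → (∀ s : ℝ, f (s, s) = 0) → ν = 0 ∨ g = 0) ∧
        ((∀ s t : ℝ, f (s, t) = f (t, s)) → (∀ s : ℝ, f (s, s) = 0) → f (1, 0) = 1 →
          μ.map Prod.swap = μ → μ (Set.diagonal Ω) = 0 → g ≠ 0 →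
            μ = ENNReal.ofReal
                (1 / (2 * volume.real (Ω : Set (EuclideanSpace ℝ (Fin d))))) •
                  lebesgueOnProd Ω ∧
            ν = 0 ∧ ∀ s t : ℝ, f (s, t) = |s - t| ^ 2)) ∧
    -- for `p = 2` the canonical representation does hold
    (p = 2 → ∀ g : ℝ → ℝ,
      IsRepresentedBy F (fun z => |z.1 - z.2| ^ 2) g
        (ENNReal.ofReal (1 / (2 * volume.real (Ω : Set (EuclideanSpace ℝ (Fin d))))) •
          lebesgueOnProd Ω) 0) := by
  have hp1 : 1 < p := Fact.out
  have hd : d ≠ 0 := by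
    rintro rfl
    norm_num at hpd
    linarith
  have hVtop : volume (Ω : Set (EuclideanSpace ℝ (Fin d))) ≠ ⊤ := hΩbdd.measure_lt_top.ne
  have hV : 0 < volume.real (Ω : Set (EuclideanSpace ℝ (Fin d))) :=
    ENNReal.toReal_pos (Ω.isOpen.measure_pos volume ⟨0, hΩ0⟩).ne' hVtop
  have : IsFiniteMeasure (volume.restrict (Ω : Set (EuclideanSpace ℝ (Fin d)))) :=
    isFiniteMeasure_restrict.2 hVtop
  have hFval := gammaLimit_testToW0_eq hΩ0 hpd hεpos hεlim hF
  refine ⟨fun f g μ ν hf hg hμ hν hrep => ?_, fun hp2 g φ => ?_⟩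
  · have H : ∀ φ : 𝓓(Ω, ℝ), (∫ z : Ω × Ω, f (φ z.1, φ z.2) ∂μ) + (∫ x : Ω, g (φ x) ∂ν) =
        lpOsc (volume.restrict (Ω : Set (EuclideanSpace ℝ (Fin d)))) p φ := fun φ =>
      add_right_cancel (EReal.coe_eq_coe_iff.1 ((hrep φ).symm.trans (hFval φ)))
    have hp2 := exponent_eq_two hd hΩbdd hV hf hg H
    subst hp2
    obtain ⟨c, hc, hk, hE⟩ := exists_kernel_and_measure hd hΩbdd hV hf hg H
    have hb : (∀ s : ℝ, f (s, s) = 0) → ν = 0 ∨ g = 0 := fun hdiag =>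
      measure_eq_zero_or_eq_zero hf hg hdiag H
    refine ⟨rfl, ⟨c, hc, hk, hE⟩, fun _ => hb, fun hsymm hdiag h10 hμs hμd hg0 => ?_⟩
    have hc1 : c = 1 := by
      have := hk 1 0
      rw [← hsymm 1 0, hdiag, hdiag, h10, sub_zero, sub_zero, sub_zero, abs_one] at this
      linarith
    subst hc1
    refine ⟨?_, (hb hdiag).resolve_right hg0, fun s t => ?_⟩
    · have hoff : ∀ E : Set (Ω × Ω), MeasurableSet E → Disjoint E (Set.diagonal Ω) →
          μ E = ENNReal.ofReal (1 / (2 * volume.real (Ω : Set (EuclideanSpace ℝ (Fin d))))) *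
            lebesgueOnProd Ω E := by
        intro E hEm hEd
        have h2 := hE E hEm hEd
        have h3 : μ (Prod.swap ⁻¹' E) = μ E := by
          rw [← Measure.map_apply measurable_swap hEm, hμs]
        have h4 : 1 / (1 * volume.real (Ω : Set (EuclideanSpace ℝ (Fin d)))) =
            2 * (1 / (2 * volume.real (Ω : Set (EuclideanSpace ℝ (Fin d))))) := by
          field_simp
        rw [h3, ← two_mul, h4, ENNReal.ofReal_mul (by norm_num), mul_assoc,
          ENNReal.ofReal_ofNat] at h2
        exact (ENNReal.mul_right_inj (by norm_num) (by norm_num)).1 h2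
      refine Measure.ext fun E hEm => ?_
      rw [Measure.smul_apply, smul_eq_mul, ← measure_sdiff_null hμd,
        ← measure_sdiff_null (lebesgueOnProd_diagonal hd)]
      exact hoff _ (hEm.diff measurableSet_diagonal) Set.disjoint_sdiff_left
    · have := hk s t
      rw [← hsymm s t, hdiag, hdiag] at this
      linarith
  · subst hp2
    have : IsFiniteMeasure (lebesgueOn Ω) := isFiniteMeasure_lebesgueOn
    have hVl : (lebesgueOn Ω).real Set.univ =
        volume.real (Ω : Set (EuclideanSpace ℝ (Fin d))) := by
      rw [measureReal_def, lebesgueOn_apply, Set.image_univ, Subtype.range_coe]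
      rfl
    obtain ⟨K, hK, hφK, -⟩ := φ.exists_bound
    have hm : Measurable fun x : Ω => φ x :=
      φ.continuous.measurable.comp measurable_subtype_coe
    have i1 : Integrable (fun x : Ω => φ x) (lebesgueOn Ω) :=
      Integrable.of_bound hm.aestronglyMeasurable K (ae_of_all _ fun x => hφK x)
    have i2 : Integrable (fun x : Ω => φ x ^ 2) (lebesgueOn Ω) := by
      refine Integrable.of_bound (hm.pow_const 2).aestronglyMeasurable (K ^ 2)
        (ae_of_all _ fun x => ?_)
      rw [norm_pow]
      exact pow_le_pow_left₀ (norm_nonneg _) (hφK x) 2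
    rw [hFval φ, ← lpOsc_lebesgueOn, lpOsc_two_eq_integral_prod (by rw [hVl]; exact hV) i1 i2, hVl,
      integral_smul_measure, integral_zero_measure, add_zero,
      ENNReal.toReal_ofReal (by positivity), smul_eq_mul, lebesgueOnProd]
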